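/- **Proposition 2.1 (existence of minimizers).** Let $n\ge 1$ and let $\Omega\subset\mathbb R^n$ be a nonempty bounded open set (for instance, a bounded smooth domain). Let $\delta,\gamma:\Omega\to[0,\infty)$ be bounded measurable functions such that $$0<\gamma_*(\Omega):=\operatorname*{ess\,inf}_{\Omega}\gamma\ \le\ \gamma^*(\Omega):=\operatorname*{ess\,sup}_{\Omega}\gamma\ \le\ 1,$$ and let $\varphi\in H^1(\Omega)\cap L^\infty(\Omega)$ with $\varphi\ge 0$ a.e. in $\Omega$. Write $v^+=\max\{v,0\}$, let $H^1_0(\Omega)$ be the closure of $C_c^\infty(\Omega)$ in $H^1(\Omega)$, and consider the functional $$\mathcal J(v)=\int_\Omega \tfrac12|Dv|^2+\delta(x)\,(v^+)^{\gamma(x)}\,dx$$ on the class $\mathcal A=\{v\in H^1(\Omega): v-\varphi\in H^1_0(\Omega)\}$. Then there exists $u\in\mathcal A$ such that $\mathcal J(u)\le\mathcal J(v)$ for all $v\in\mathcal A$. Furthermore, every such minimizer $u$ satisfies $u\ge 0$ a.e. in $\Omega$ and $\|u\|_{L^\infty(\Omega)}\le\|\varphi\|_{L^\infty(\Omega)}$.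 -/

import Mathlib

open MeasureTheory Set Filter Topology
open scoped ENNReal ContDiff

noncomputable section

namespace SobolevH1

variable {n : ℕ}

/-- `C_c^∞(Ω)`: smooth functions whose support is a compact subset of `Ω`. -/
structure IsTestFunction (Ω : Set (EuclideanSpace ℝ (Fin n)))
    (ψ : EuclideanSpace ℝ (Fin n) → ℝ) : Prop where
  contDiff : ContDiff ℝ ∞ ψ
  hasCompactSupport : HasCompactSupport ψ
  tsupport_subset : tsupport ψ ⊆ Ω

/-- `g` is a weak gradient of `u` in `Ω`: both are locally integrable in `Ω` and
`∫_Ω u Dψ dx = - ∫_Ω ψ g dx` (an identity of vectors) for every `ψ ∈ C_c^∞(Ω)`. -/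
structure HasWeakGradient (Ω : Set (EuclideanSpace ℝ (Fin n)))
    (u : EuclideanSpace ℝ (Fin n) → ℝ)
    (g : EuclideanSpace ℝ (Fin n) → EuclideanSpace ℝ (Fin n)) : Prop where
  locallyIntegrableOn : LocallyIntegrableOn u Ω volume
  locallyIntegrableOn_grad : LocallyIntegrableOn g Ω volume
  integral_eq : ∀ ψ : EuclideanSpace ℝ (Fin n) → ℝ, IsTestFunction Ω ψ →
    ∫ x in Ω, u x • gradient ψ x = - ∫ x in Ω, ψ x • g x

open Classical in
/-- The weak gradient `Du` of `u` in `Ω` (unique up to null sets; `0` if there is none). -/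
def weakGradient (Ω : Set (EuclideanSpace ℝ (Fin n)))
    (u : EuclideanSpace ℝ (Fin n) → ℝ) :
    EuclideanSpace ℝ (Fin n) → EuclideanSpace ℝ (Fin n) :=
  if h : ∃ g, HasWeakGradient Ω u g then h.choose else 0

/-- `u ∈ H¹(Ω)`: `u ∈ L²(Ω)` has a weak gradient in `L²(Ω)`. Only the values on `Ω` matter. -/
def MemH1 (Ω : Set (EuclideanSpace ℝ (Fin n)))
    (u : EuclideanSpace ℝ (Fin n) → ℝ) : Prop :=
  MemLp u 2 (volume.restrict Ω) ∧
    ∃ g : EuclideanSpace ℝ (Fin n) → EuclideanSpace ℝ (Fin n),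
      HasWeakGradient Ω u g ∧ MemLp g 2 (volume.restrict Ω)

/-- `w ∈ H¹₀(Ω)`: `w` lies in the closure of `C_c^∞(Ω)` in `H¹(Ω)`. -/
def MemH10 (Ω : Set (EuclideanSpace ℝ (Fin n)))
    (w : EuclideanSpace ℝ (Fin n) → ℝ) : Prop :=
  MemH1 Ω w ∧
    ∃ ψ : ℕ → EuclideanSpace ℝ (Fin n) → ℝ,
      (∀ k, IsTestFunction Ω (ψ k)) ∧
      Tendsto (fun k => eLpNorm (fun x => ψ k x - w x) 2 (volume.restrict Ω))
        atTop (𝓝 0) ∧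
      Tendsto (fun k => eLpNorm (fun x => gradient (ψ k) x - weakGradient Ω w x) 2
        (volume.restrict Ω)) atTop (𝓝 0)

/-- The functional `∫_Ω ½ |Dv|² + δ(x) (v⁺)^{γ(x)} dx`, with values in `[0, ∞]`
(the integrand is nonnegative when `δ ≥ 0`). -/
def energy (Ω : Set (EuclideanSpace ℝ (Fin n)))
    (δ γ v : EuclideanSpace ℝ (Fin n) → ℝ) : ℝ≥0∞ :=
  ∫⁻ x in Ω, ENNReal.ofReal
    (1 / 2 * ‖weakGradient Ω v x‖ ^ 2 + δ x * (max (v x) 0) ^ (γ x))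

/-- The competitors: `v ∈ H¹(Ω)` with `v - φ ∈ H¹₀(Ω)`. -/
def admissible (Ω : Set (EuclideanSpace ℝ (Fin n)))
    (φ : EuclideanSpace ℝ (Fin n) → ℝ) : Set (EuclideanSpace ℝ (Fin n) → ℝ) :=
  {v | MemH1 Ω v ∧ MemH10 Ω (fun x => v x - φ x)}

/-- `u` minimizes the functional among the competitors. -/
def IsMinimizer (Ω : Set (EuclideanSpace ℝ (Fin n)))
    (δ γ φ u : EuclideanSpace ℝ (Fin n) → ℝ) : Prop :=
  u ∈ admissible Ω φ ∧ ∀ v ∈ admissible Ω φ, energy Ω δ γ u ≤ energy Ω δ γ v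

end SobolevH1

end

/-! Existence is the direct method. Both terms of the energy are nonnegative, so a minimizing
sequence `v k` has bounded gradients, and Poincaré's inequality (`exists_poincare_const`) bounds `v
k - φ` in `H¹₀(Ω)`. A subsequence converges weakly there (`IsGradPairZero.exists_weak_limit`),
strongly in `L²` by Rellich (`IsGradPairZero.tendsto_of_weak`), and a.e. after a further extraction.
The Dirichlet term is weakly lower semicontinuous because it lies above its tangent planes. The
potential term is handled by Fatou's lemma, so its lack of convexity does no harm.

The bounds come from truncation. With `M = ‖φ‖_∞`, both `u⁺` and `min u M` are competitors whose
potential energy is no larger and whose gradients have the form `θ Du`, where `θ` is `1` or lies in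
`[0, ½]`. Minimality forces `|θ Du| = |Du|` a.e., hence `Du = 0` a.e. where `θ ≠ 1`. The truncation
and `u` then differ by an element of `H¹₀(Ω)` with zero gradient, which vanishes by Poincaré
(`IsMinimizer.ae_eq_of_gradient_factor`). Thanks to this dichotomy for `θ`, it is never needed that
gradients vanish a.e. on level sets.

The Sobolev theory rests on the estimate `‖ψ(· - y) - ψ‖ ≤ |y| ‖Dψ‖` for test functions and on
mollification; no regularity of the boundary enters. Gradients travel explicitly with their
functions, in `IsGradPair` and `IsGradPairZero`, because `weakGradient` is a choice determined only
a.e. -/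

noncomputable section

namespace SobolevH1

variable {n : ℕ}

open Convolution

/-! ### Weak sequential compactness in Hilbert space. -/

section Hilbert

variable {H : Type*} [NormedAddCommGroup H] [InnerProductSpace ℝ H] [CompleteSpace H]

/-- A bounded sequence in a closed subspace of a separable Hilbert space has a subsequence
converging weakly to a point of that subspace. -/
theorem exists_subseq_weak_tendsto [TopologicalSpace.SeparableSpace H] (K : Submodule ℝ H)
    (hK : IsClosed (K : Set H)) (x : ℕ → H) (hx : ∀ k, x k ∈ K) (C : ℝ) (hC : ∀ k, ‖x k‖ ≤ C) :
    ∃ y ∈ K, ∃ σ : ℕ → ℕ, StrictMono σ ∧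
      ∀ z, Tendsto (fun k => inner ℝ (x (σ k)) z) atTop (𝓝 (inner ℝ y z)) := by
  -- Riesz turns the sequence into bounded functionals, to which sequential Banach–Alaoglu applies.
  let D : ℕ → WeakDual ℝ H := fun k =>
    StrongDual.toWeakDual (InnerProductSpace.toDual ℝ H (x k))
  have hD : ∀ k, D k ∈ WeakDual.toStrongDual ⁻¹' Metric.closedBall (0 : StrongDual ℝ H) C := by
    intro k
    simpa [D] using hC k
  obtain ⟨L, -, σ, hσ, hL⟩ := WeakDual.isSeqCompact_closedBall ℝ H 0 C hD
  let y : H := (InnerProductSpace.toDual ℝ H).symm (WeakDual.toStrongDual L)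
  have hlim : ∀ z, Tendsto (fun k => inner ℝ (x (σ k)) z) atTop (𝓝 (inner ℝ y z)) := by
    intro z
    have h := ((WeakDual.eval_continuous z).tendsto L).comp hL
    have e : inner ℝ y z = L z := by
      simp only [y, InnerProductSpace.toDual_symm_apply]; rfl
    rw [e]
    exact h
  refine ⟨y, ?_, σ, hσ, hlim⟩
  have : K.HasOrthogonalProjection := by
    have : CompleteSpace K := hK.completeSpace_coe
    infer_instance
  -- A closed subspace is its own double orthogonal complement, and orthogonality to a fixed `z`
  -- passes to weak limits.
  rw [← K.orthogonal_orthogonal, Submodule.mem_orthogonal']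
  intro z hz
  refine tendsto_nhds_unique (hlim z) ?_
  have : ∀ k, inner ℝ (x (σ k)) z = 0 := fun k => (Submodule.mem_orthogonal K z).1 hz _ (hx _)
  simp [this]

end Hilbert

/-! ### Products of square integrable functions. -/

section Lebesgue

variable {α : Type*} [MeasurableSpace α] {μ : Measure α}
  {F : Type*} [NormedAddCommGroup F] [NormedSpace ℝ F]

theorem eLpNorm_smul_one_le {u : α → ℝ} {g : α → F} (hu : AEStronglyMeasurable u μ)
    (hg : AEStronglyMeasurable g μ) :
    eLpNorm (fun x => u x • g x) 1 μ ≤ eLpNorm u 2 μ * eLpNorm g 2 μ := by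
  have : ENNReal.HolderTriple 2 2 1 := ⟨by simp [ENNReal.inv_two_add_inv_two]⟩
  exact eLpNorm_smul_le_mul_eLpNorm (p := 2) (q := 2) (r := 1) hg hu

theorem integrable_smul_of_memLp_two {u : α → ℝ} {g : α → F} (hu : MemLp u 2 μ)
    (hg : MemLp g 2 μ) : Integrable (fun x => u x • g x) μ := by
  have : ENNReal.HolderTriple 2 2 1 := ⟨by simp [ENNReal.inv_two_add_inv_two]⟩
  exact memLp_one_iff_integrable.1 (MemLp.smul (p := 2) (q := 2) (r := 1) hg hu)

theorem tendsto_eLpNorm_zero_of_le {ι : Type*} {l : Filter ι} {f g : ι → ℝ≥0∞}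
    (h : Tendsto g l (𝓝 0)) (hfg : ∀ i, f i ≤ g i) : Tendsto f l (𝓝 0) :=
  tendsto_of_tendsto_of_tendsto_of_le_of_le tendsto_const_nhds h (fun _ => zero_le) hfg

/-- The products converge in `L¹`: split `u_k g_k - v h = (u_k - v)(g_k - h) + (u_k - v) h + v (g_k
- h)` and apply Hölder to each term. -/
theorem tendsto_integral_smul_of_L2 {u : ℕ → α → ℝ} {g : ℕ → α → F} {v : α → ℝ} {h : α → F}
    (hu : ∀ k, MemLp (u k) 2 μ) (hg : ∀ k, MemLp (g k) 2 μ) (hv : MemLp v 2 μ) (hh : MemLp h 2 μ)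
    (huv : Tendsto (fun k => eLpNorm (fun x => u k x - v x) 2 μ) atTop (𝓝 0))
    (hgh : Tendsto (fun k => eLpNorm (fun x => g k x - h x) 2 μ) atTop (𝓝 0)) :
    Tendsto (fun k => ∫ x, u k x • g k x ∂μ) atTop (𝓝 (∫ x, v x • h x ∂μ)) := by
  refine tendsto_integral_of_L1' _ (integrable_smul_of_memLp_two hv hh).aestronglyMeasurable
    (Eventually.of_forall fun k => integrable_smul_of_memLp_two (hu k) (hg k)) ?_
  have hb : ∀ k, eLpNorm (fun x => u k x • g k x - v x • h x) 1 μ ≤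
      eLpNorm (fun x => u k x - v x) 2 μ * eLpNorm (fun x => g k x - h x) 2 μ
      + eLpNorm (fun x => u k x - v x) 2 μ * eLpNorm h 2 μ
      + eLpNorm v 2 μ * eLpNorm (fun x => g k x - h x) 2 μ := by
    intro k
    have m1 := ((hu k).sub hv).aestronglyMeasurable
    have m2 := ((hg k).sub hh).aestronglyMeasurable
    have e : (fun x => u k x • g k x - v x • h x) =
        (fun x => (u k x - v x) • (g k x - h x)) + (fun x => (u k x - v x) • h x)
        + fun x => v x • (g k x - h x) := by
      ext x
      simp only [Pi.add_apply]
      module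
    rw [e]
    refine (eLpNorm_add_le ((m1.smul m2).add (m1.smul hh.aestronglyMeasurable))
      (hv.aestronglyMeasurable.smul m2) le_rfl).trans ?_
    refine add_le_add ((eLpNorm_add_le (m1.smul m2) (m1.smul hh.aestronglyMeasurable)
      le_rfl).trans (add_le_add ?_ ?_)) ?_
    · exact eLpNorm_smul_one_le m1 m2
    · exact eLpNorm_smul_one_le m1 hh.aestronglyMeasurable
    · exact eLpNorm_smul_one_le hv.aestronglyMeasurable m2
  refine tendsto_eLpNorm_zero_of_le ?_ hb
  have t1 := ENNReal.Tendsto.mul huv (by simp) hgh (by simp)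
  have t2 := ENNReal.Tendsto.mul_const (b := eLpNorm h 2 μ) huv (Or.inr hh.2.ne)
  have t3 := ENNReal.Tendsto.const_mul (a := eLpNorm v 2 μ) hgh (Or.inr hv.2.ne)
  simpa using (t1.add t2).add t3

end Lebesgue

/-! ### Calculus of classical gradients. -/

section Gradient

theorem hasGradientAt_of_contDiff {E : Type*} [NormedAddCommGroup E] [InnerProductSpace ℝ E]
    [CompleteSpace E] {ψ : E → ℝ} (h : ContDiff ℝ 1 ψ) (x : E) :
    HasGradientAt ψ (gradient ψ x) x :=
  ((h.differentiable one_ne_zero) x).hasGradientAt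

variable {ψ η : EuclideanSpace ℝ (Fin n) → ℝ}

theorem gradient_eq_toDual_symm (ψ : EuclideanSpace ℝ (Fin n) → ℝ) :
    gradient ψ = fun x => (InnerProductSpace.toDual ℝ _).symm (fderiv ℝ ψ x) := rfl

theorem continuous_gradient (h : ContDiff ℝ 1 ψ) : Continuous (gradient ψ) := by
  rw [gradient_eq_toDual_symm]
  exact (InnerProductSpace.toDual ℝ (EuclideanSpace ℝ (Fin n))).symm.continuous.comp
    (h.continuous_fderiv one_ne_zero)

theorem gradient_eq_zero_of_notMem_tsupport {x : EuclideanSpace ℝ (Fin n)}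
    (hx : x ∉ tsupport ψ) : gradient ψ x = 0 := by
  have : ψ =ᶠ[𝓝 x] fun _ => 0 := notMem_tsupport_iff_eventuallyEq.1 hx
  rw [this.gradient_eq, gradient_fun_const]

theorem hasCompactSupport_gradient (h : HasCompactSupport ψ) : HasCompactSupport (gradient ψ) :=
  HasCompactSupport.intro h fun _ hx => gradient_eq_zero_of_notMem_tsupport hx

theorem gradient_mul (hψ : ContDiff ℝ 1 ψ) (hη : ContDiff ℝ 1 η) (x : EuclideanSpace ℝ (Fin n)) :
    gradient (fun y => ψ y * η y) x = ψ x • gradient η x + η x • gradient ψ x := by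
  refine HasGradientAt.gradient ?_
  rw [hasGradientAt_iff_hasFDerivAt, map_add, map_smul, map_smul]
  exact (hasGradientAt_of_contDiff hψ x).hasFDerivAt.mul
    (hasGradientAt_of_contDiff hη x).hasFDerivAt

theorem gradient_add (hψ : ContDiff ℝ 1 ψ) (hη : ContDiff ℝ 1 η) (x : EuclideanSpace ℝ (Fin n)) :
    gradient (fun y => ψ y + η y) x = gradient ψ x + gradient η x := by
  refine HasGradientAt.gradient ?_
  rw [hasGradientAt_iff_hasFDerivAt, map_add]
  exact (hasGradientAt_of_contDiff hψ x).hasFDerivAt.add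
    (hasGradientAt_of_contDiff hη x).hasFDerivAt

theorem gradient_const_mul (c : ℝ) (hψ : ContDiff ℝ 1 ψ) (x : EuclideanSpace ℝ (Fin n)) :
    gradient (fun y => c * ψ y) x = c • gradient ψ x := by
  refine HasGradientAt.gradient ?_
  rw [hasGradientAt_iff_hasFDerivAt, map_smul]
  exact (hasGradientAt_of_contDiff hψ x).hasFDerivAt.const_mul c

theorem gradient_comp_real {G : ℝ → ℝ} (hG : ContDiff ℝ 1 G) (hψ : ContDiff ℝ 1 ψ)
    (x : EuclideanSpace ℝ (Fin n)) :
    gradient (fun y => G (ψ y)) x = deriv G (ψ x) • gradient ψ x := by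
  refine HasGradientAt.gradient ?_
  rw [hasGradientAt_iff_hasFDerivAt, map_smul]
  exact ((hG.differentiable one_ne_zero (ψ x)).hasDerivAt).comp_hasFDerivAt x
    (hasGradientAt_of_contDiff hψ x).hasFDerivAt

theorem integral_gradient_eq_zero (hψ : ContDiff ℝ 1 ψ) (hc : HasCompactSupport ψ) :
    ∫ x, gradient ψ x = 0 := by
  have hi : Integrable (gradient ψ) :=
    (continuous_gradient hψ).integrable_of_hasCompactSupport (hasCompactSupport_gradient hc)
  refine ext_inner_left ℝ fun v => ?_
  rw [← integral_inner hi, inner_zero_right]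
  have hi' : Integrable (fun x => fderiv ℝ ψ x v) := by
    simpa only [inner_gradient_right, conj_trivial] using hi.const_inner (𝕜 := ℝ) v
  -- Integration by parts against the constant function `1`.
  have := integral_mul_fderiv_eq_neg_fderiv_mul_of_integrable (μ := volume) (f := fun _ => (1 : ℝ))
    (g := ψ) (v := v) (by simp) (by simpa using hi')
    (by simpa using hψ.continuous.integrable_of_hasCompactSupport hc)
    (by intros; fun_prop) (fun x _ => hψ.differentiable one_ne_zero x)
  simpa [inner_gradient_right] using this

end Gradient

/-! ### Test functions. -/

section TestFunction

variable {Ω : Set (EuclideanSpace ℝ (Fin n))} {ψ η : EuclideanSpace ℝ (Fin n) → ℝ}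

namespace IsTestFunction

theorem contDiff_one (h : IsTestFunction Ω ψ) : ContDiff ℝ 1 ψ :=
  h.contDiff.of_le (by exact_mod_cast le_top)

theorem memLp (h : IsTestFunction Ω ψ) (p : ℝ≥0∞) (s : Set (EuclideanSpace ℝ (Fin n))) :
    MemLp ψ p (volume.restrict s) :=
  (h.contDiff.continuous.memLp_of_hasCompactSupport h.hasCompactSupport).restrict s

theorem memLp_gradient (h : IsTestFunction Ω ψ) (p : ℝ≥0∞)
    (s : Set (EuclideanSpace ℝ (Fin n))) : MemLp (gradient ψ) p (volume.restrict s) :=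
  ((continuous_gradient h.contDiff_one).memLp_of_hasCompactSupport
    (hasCompactSupport_gradient h.hasCompactSupport)).restrict s

theorem eq_zero (h : IsTestFunction Ω ψ) {x : EuclideanSpace ℝ (Fin n)} (hx : x ∉ Ω) :
    ψ x = 0 :=
  image_eq_zero_of_notMem_tsupport fun hx' => hx (h.tsupport_subset hx')

theorem gradient_eq_zero (h : IsTestFunction Ω ψ) {x : EuclideanSpace ℝ (Fin n)} (hx : x ∉ Ω) :
    gradient ψ x = 0 :=
  gradient_eq_zero_of_notMem_tsupport fun hx' => hx (h.tsupport_subset hx')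

theorem contDiff_mul (hη : ContDiff ℝ ∞ η) (h : IsTestFunction Ω ψ) :
    IsTestFunction Ω (fun x => η x * ψ x) where
  contDiff := hη.mul h.contDiff
  hasCompactSupport := h.hasCompactSupport.mul_left
  tsupport_subset := (tsupport_mul_subset_right (f := η) (g := ψ)).trans h.tsupport_subset

theorem const_mul (c : ℝ) (h : IsTestFunction Ω ψ) : IsTestFunction Ω (fun x => c * ψ x) :=
  contDiff_mul contDiff_const h

theorem add (h : IsTestFunction Ω ψ) (h' : IsTestFunction Ω η) :
    IsTestFunction Ω (fun x => ψ x + η x) where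
  contDiff := h.contDiff.add h'.contDiff
  hasCompactSupport := h.hasCompactSupport.add h'.hasCompactSupport
  tsupport_subset := (tsupport_add ψ η).trans (union_subset h.tsupport_subset h'.tsupport_subset)

theorem zero : IsTestFunction Ω (fun _ => 0) where
  contDiff := contDiff_const
  hasCompactSupport := HasCompactSupport.zero
  tsupport_subset := by simp [tsupport]

end IsTestFunction

/-- The two integrands add up to `D(uψ)`, which vanishes off `Ω` and has integral zero over the
whole space. Hence nothing is asked of the boundary of `Ω`. -/
theorem integral_smul_gradient_of_contDiff {u : EuclideanSpace ℝ (Fin n) → ℝ}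
    (hu : ContDiff ℝ 1 u) (h : IsTestFunction Ω ψ) :
    ∫ x in Ω, u x • gradient ψ x = - ∫ x in Ω, ψ x • gradient u x := by
  have hi : Integrable (fun x => u x • gradient ψ x) (volume.restrict Ω) :=
    ((hu.continuous.smul (continuous_gradient h.contDiff_one)).integrable_of_hasCompactSupport
      (hasCompactSupport_gradient h.hasCompactSupport).smul_left).restrict
  have hi' : Integrable (fun x => ψ x • gradient u x) (volume.restrict Ω) :=
    ((h.contDiff.continuous.smul (continuous_gradient hu)).integrable_of_hasCompactSupport
      h.hasCompactSupport.smul_right).restrict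
  rw [← add_eq_zero_iff_eq_neg, ← integral_add hi hi']
  have e : ∀ x, u x • gradient ψ x + ψ x • gradient u x = gradient (fun y => u y * ψ y) x :=
    fun x => (gradient_mul hu h.contDiff_one x).symm
  simp only [e]
  rw [setIntegral_eq_integral_of_forall_compl_eq_zero]
  · exact integral_gradient_eq_zero (hu.mul h.contDiff_one) h.hasCompactSupport.mul_left
  · intro x hx
    rw [← e, h.eq_zero hx, h.gradient_eq_zero hx]
    simp

end TestFunction

/-! ### Weak gradients, `H¹(Ω)` and `H¹₀(Ω)` as sets of pairs. -/

/-- A pair of square integrable functions on `Ω`, the second of which is the weak gradient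
of the first. -/
structure IsGradPair (Ω : Set (EuclideanSpace ℝ (Fin n))) (u : EuclideanSpace ℝ (Fin n) → ℝ)
    (g : EuclideanSpace ℝ (Fin n) → EuclideanSpace ℝ (Fin n)) : Prop where
  memLp : MemLp u 2 (volume.restrict Ω)
  memLp_grad : MemLp g 2 (volume.restrict Ω)
  integral_eq : ∀ ψ : EuclideanSpace ℝ (Fin n) → ℝ, IsTestFunction Ω ψ →
    ∫ x in Ω, u x • gradient ψ x = - ∫ x in Ω, ψ x • g x

/-- A pair of square integrable functions on `Ω` that is the `L²` limit of pairs `(ψ, Dψ)`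
with `ψ ∈ C_c^∞(Ω)`. -/
structure IsGradPairZero (Ω : Set (EuclideanSpace ℝ (Fin n)))
    (u : EuclideanSpace ℝ (Fin n) → ℝ)
    (g : EuclideanSpace ℝ (Fin n) → EuclideanSpace ℝ (Fin n)) : Prop where
  memLp : MemLp u 2 (volume.restrict Ω)
  memLp_grad : MemLp g 2 (volume.restrict Ω)
  exists_seq : ∃ ψ : ℕ → EuclideanSpace ℝ (Fin n) → ℝ, (∀ k, IsTestFunction Ω (ψ k)) ∧
    Tendsto (fun k => eLpNorm (fun x => ψ k x - u x) 2 (volume.restrict Ω)) atTop (𝓝 0) ∧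
    Tendsto (fun k => eLpNorm (fun x => gradient (ψ k) x - g x) 2 (volume.restrict Ω))
      atTop (𝓝 0)

section Pair

variable {Ω : Set (EuclideanSpace ℝ (Fin n))} {u v : EuclideanSpace ℝ (Fin n) → ℝ}
  {g h : EuclideanSpace ℝ (Fin n) → EuclideanSpace ℝ (Fin n)}

theorem IsTestFunction.isGradPair {ψ : EuclideanSpace ℝ (Fin n) → ℝ} (hψ : IsTestFunction Ω ψ) :
    IsGradPair Ω ψ (gradient ψ) :=
  ⟨hψ.memLp 2 Ω, hψ.memLp_gradient 2 Ω,
    fun _ hη => integral_smul_gradient_of_contDiff hψ.contDiff_one hη⟩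

theorem IsTestFunction.isGradPairZero {ψ : EuclideanSpace ℝ (Fin n) → ℝ}
    (hψ : IsTestFunction Ω ψ) : IsGradPairZero Ω ψ (gradient ψ) :=
  ⟨hψ.memLp 2 Ω, hψ.memLp_gradient 2 Ω, fun _ => ψ, fun _ => hψ, by simp, by simp⟩

namespace IsGradPair

theorem congr (H : IsGradPair Ω u g) (huv : u =ᵐ[volume.restrict Ω] v)
    (hgh : g =ᵐ[volume.restrict Ω] h) : IsGradPair Ω v h where
  memLp := H.memLp.ae_eq huv
  memLp_grad := H.memLp_grad.ae_eq hgh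
  integral_eq ψ hψ := by
    have e1 : ∫ x in Ω, v x • gradient ψ x = ∫ x in Ω, u x • gradient ψ x :=
      integral_congr_ae (huv.mono fun x hx => by simp only [hx])
    have e2 : ∫ x in Ω, ψ x • h x = ∫ x in Ω, ψ x • g x :=
      integral_congr_ae (hgh.mono fun x hx => by simp only [hx])
    rw [e1, e2, H.integral_eq ψ hψ]

theorem add (H : IsGradPair Ω u g) (H' : IsGradPair Ω v h) :
    IsGradPair Ω (fun x => u x + v x) (fun x => g x + h x) where
  memLp := H.memLp.add H'.memLp
  memLp_grad := H.memLp_grad.add H'.memLp_grad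
  integral_eq ψ hψ := by
    simp only [add_smul, smul_add]
    rw [integral_add (integrable_smul_of_memLp_two H.memLp (hψ.memLp_gradient 2 Ω))
      (integrable_smul_of_memLp_two H'.memLp (hψ.memLp_gradient 2 Ω)),
      integral_add (integrable_smul_of_memLp_two (hψ.memLp 2 Ω) H.memLp_grad)
      (integrable_smul_of_memLp_two (hψ.memLp 2 Ω) H'.memLp_grad), H.integral_eq ψ hψ,
      H'.integral_eq ψ hψ, neg_add]

theorem const_mul (c : ℝ) (H : IsGradPair Ω u g) :
    IsGradPair Ω (fun x => c * u x) (fun x => c • g x) where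
  memLp := H.memLp.const_mul c
  memLp_grad := H.memLp_grad.const_smul c
  integral_eq ψ hψ := by
    simp only [mul_smul, smul_comm _ c]
    rw [integral_smul, integral_smul, H.integral_eq ψ hψ, smul_neg]

theorem neg (H : IsGradPair Ω u g) : IsGradPair Ω (fun x => - u x) (fun x => - g x) := by
  simpa using H.const_mul (-1)

theorem sub (H : IsGradPair Ω u g) (H' : IsGradPair Ω v h) :
    IsGradPair Ω (fun x => u x - v x) (fun x => g x - h x) := by
  simpa only [sub_eq_add_neg] using H.add H'.neg

theorem const (hΩ : Bornology.IsBounded Ω) (c : ℝ) :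
    IsGradPair Ω (fun _ => c) (fun _ => 0) := by
  have : IsFiniteMeasure (volume.restrict Ω) := ⟨by simpa using hΩ.measure_lt_top⟩
  refine ⟨memLp_const c, memLp_const 0, fun ψ hψ => ?_⟩
  have := integral_smul_gradient_of_contDiff (u := fun _ => c) contDiff_const hψ
  simpa using this

/-- Both sides of the integration by parts identity are continuous in `L²`, so the weak gradient is
a closed operator. -/
theorem of_tendsto {U : ℕ → EuclideanSpace ℝ (Fin n) → ℝ}
    {G : ℕ → EuclideanSpace ℝ (Fin n) → EuclideanSpace ℝ (Fin n)}
    (H : ∀ k, IsGradPair Ω (U k) (G k)) (hu : MemLp u 2 (volume.restrict Ω))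
    (hg : MemLp g 2 (volume.restrict Ω))
    (hU : Tendsto (fun k => eLpNorm (fun x => U k x - u x) 2 (volume.restrict Ω)) atTop (𝓝 0))
    (hG : Tendsto (fun k => eLpNorm (fun x => G k x - g x) 2 (volume.restrict Ω)) atTop (𝓝 0)) :
    IsGradPair Ω u g := by
  refine ⟨hu, hg, fun ψ hψ => ?_⟩
  have t1 := tendsto_integral_smul_of_L2 (fun k => (H k).memLp)
    (fun _ => hψ.memLp_gradient 2 Ω) hu (hψ.memLp_gradient 2 Ω) hU (by simp)
  have t2 := tendsto_integral_smul_of_L2 (fun _ => hψ.memLp 2 Ω) (fun k => (H k).memLp_grad)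
    (hψ.memLp 2 Ω) hg (by simp) hG
  refine tendsto_nhds_unique t1 ?_
  simpa only [(H _).integral_eq ψ hψ] using t2.neg

theorem hasWeakGradient (hΩ : Bornology.IsBounded Ω) (H : IsGradPair Ω u g) :
    HasWeakGradient Ω u g := by
  have : IsFiniteMeasure (volume.restrict Ω) := ⟨by simpa using hΩ.measure_lt_top⟩
  have h2 : (1 : ℝ≥0∞) ≤ 2 := by norm_num
  exact ⟨IntegrableOn.locallyIntegrableOn (H.memLp.integrable h2),
    IntegrableOn.locallyIntegrableOn (H.memLp_grad.integrable h2), H.integral_eq⟩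

end IsGradPair

/-- The fundamental lemma of the calculus of variations, applied to `g - h`. -/
theorem HasWeakGradient.ae_eq (hΩ : IsOpen Ω) (H : HasWeakGradient Ω u g)
    (H' : HasWeakGradient Ω u h) : g =ᵐ[volume.restrict Ω] h := by
  have hz := hΩ.ae_eq_zero_of_integral_contDiff_smul_eq_zero (μ := volume)
    (H.locallyIntegrableOn_grad.sub H'.locallyIntegrableOn_grad) fun ψ h1 h2 h3 => by
      have hψ : IsTestFunction Ω ψ := ⟨h1, h2, h3⟩
      have key : ∀ {g : EuclideanSpace ℝ (Fin n) → EuclideanSpace ℝ (Fin n)},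
          LocallyIntegrableOn g Ω volume → Integrable (fun x => ψ x • g x) := by
        intro g hg
        have hK : IntegrableOn g (tsupport ψ) volume :=
          hg.integrableOn_compact_subset h3 h2
        have := hK.continuousOn_smul h1.continuous.continuousOn h2
        refine (integrableOn_iff_integrable_of_support_subset ?_).1 this
        intro x hx
        refine subset_tsupport ψ fun h0 => hx ?_
        simp [h0]
      have e : ∀ {g : EuclideanSpace ℝ (Fin n) → EuclideanSpace ℝ (Fin n)},
          ∫ x in Ω, ψ x • g x = ∫ x, ψ x • g x := fun {g} =>
        setIntegral_eq_integral_of_forall_compl_eq_zero fun x hx => by simp [hψ.eq_zero hx]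
      have e1 := H.integral_eq ψ hψ
      have e2 := H'.integral_eq ψ hψ
      rw [e] at e1 e2
      simp only [Pi.sub_apply, smul_sub]
      rw [integral_sub (key H.locallyIntegrableOn_grad) (key H'.locallyIntegrableOn_grad),
        sub_eq_zero]
      exact neg_injective (e1.symm.trans e2)
  rw [EventuallyEq, ae_restrict_iff' hΩ.measurableSet]
  filter_upwards [hz] with x hx hxΩ
  exact sub_eq_zero.1 (hx hxΩ)

theorem HasWeakGradient.weakGradient_ae_eq (hΩ : IsOpen Ω) (H : HasWeakGradient Ω u g) :
    weakGradient Ω u =ᵐ[volume.restrict Ω] g := by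
  have hex : ∃ g, HasWeakGradient Ω u g := ⟨g, H⟩
  have : weakGradient Ω u = hex.choose := by rw [weakGradient, dif_pos hex]
  rw [this]
  exact hex.choose_spec.ae_eq hΩ H

theorem IsGradPair.weakGradient_ae_eq (hΩ : IsOpen Ω) (hΩb : Bornology.IsBounded Ω)
    (H : IsGradPair Ω u g) : weakGradient Ω u =ᵐ[volume.restrict Ω] g :=
  (H.hasWeakGradient hΩb).weakGradient_ae_eq hΩ

theorem IsGradPair.memH1 (hΩb : Bornology.IsBounded Ω) (H : IsGradPair Ω u g) : MemH1 Ω u :=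
  ⟨H.memLp, g, H.hasWeakGradient hΩb, H.memLp_grad⟩

theorem MemH1.isGradPair (hΩ : IsOpen Ω) (H : MemH1 Ω u) :
    IsGradPair Ω u (weakGradient Ω u) := by
  obtain ⟨hu, g, hg, hgL⟩ := H
  exact (IsGradPair.mk hu hgL hg.integral_eq).congr EventuallyEq.rfl
    (hg.weakGradient_ae_eq hΩ).symm

namespace IsGradPairZero

theorem isGradPair (H : IsGradPairZero Ω u g) : IsGradPair Ω u g := by
  obtain ⟨ψ, hψ, h1, h2⟩ := H.exists_seq
  exact IsGradPair.of_tendsto (fun k => (hψ k).isGradPair) H.memLp H.memLp_grad h1 h2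

theorem congr (H : IsGradPairZero Ω u g) (huv : u =ᵐ[volume.restrict Ω] v)
    (hgh : g =ᵐ[volume.restrict Ω] h) : IsGradPairZero Ω v h := by
  obtain ⟨ψ, hψ, h1, h2⟩ := H.exists_seq
  refine ⟨H.memLp.ae_eq huv, H.memLp_grad.ae_eq hgh, ψ, hψ, ?_, ?_⟩
  · refine h1.congr fun k => eLpNorm_congr_ae ?_
    filter_upwards [huv] with x hx
    rw [hx]
  · refine h2.congr fun k => eLpNorm_congr_ae ?_
    filter_upwards [hgh] with x hx
    rw [hx]

theorem add (H : IsGradPairZero Ω u g) (H' : IsGradPairZero Ω v h) :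
    IsGradPairZero Ω (fun x => u x + v x) (fun x => g x + h x) := by
  obtain ⟨ψ, hψ, h1, h2⟩ := H.exists_seq
  obtain ⟨η, hη, h1', h2'⟩ := H'.exists_seq
  refine ⟨H.memLp.add H'.memLp, H.memLp_grad.add H'.memLp_grad, fun k x => ψ k x + η k x,
    fun k => (hψ k).add (hη k), ?_, ?_⟩
  · have ht := h1.add h1'
    rw [add_zero] at ht
    refine tendsto_eLpNorm_zero_of_le ht fun k => ?_
    have e : (fun x => ψ k x + η k x - (u x + v x)) =
        (fun x => ψ k x - u x) + fun x => η k x - v x := by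
      ext x; simp only [Pi.add_apply]; ring
    rw [e]
    exact eLpNorm_add_le (((hψ k).memLp 2 Ω).sub H.memLp).aestronglyMeasurable
      (((hη k).memLp 2 Ω).sub H'.memLp).aestronglyMeasurable (by norm_num)
  · have ht := h2.add h2'
    rw [add_zero] at ht
    refine tendsto_eLpNorm_zero_of_le ht fun k => ?_
    have e : (fun x => gradient (fun x => ψ k x + η k x) x - (g x + h x)) =
        (fun x => gradient (ψ k) x - g x) + fun x => gradient (η k) x - h x := by
      ext1 x
      rw [gradient_add (hψ k).contDiff_one (hη k).contDiff_one]
      simp only [Pi.add_apply]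
      abel
    rw [e]
    exact eLpNorm_add_le (((hψ k).memLp_gradient 2 Ω).sub H.memLp_grad).aestronglyMeasurable
      (((hη k).memLp_gradient 2 Ω).sub H'.memLp_grad).aestronglyMeasurable (by norm_num)

theorem const_mul (c : ℝ) (H : IsGradPairZero Ω u g) :
    IsGradPairZero Ω (fun x => c * u x) (fun x => c • g x) := by
  obtain ⟨ψ, hψ, h1, h2⟩ := H.exists_seq
  refine ⟨H.memLp.const_mul c, H.memLp_grad.const_smul c, fun k x => c * ψ k x,
    fun k => (hψ k).const_mul c, ?_, ?_⟩
  · have ht := ENNReal.Tendsto.const_mul (a := ‖c‖ₑ) h1 (Or.inr (by simp))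
    rw [mul_zero] at ht
    refine ht.congr fun k => ?_
    rw [← eLpNorm_const_smul]
    congr 1
    ext x; simp only [Pi.smul_apply, smul_eq_mul]; ring
  · have ht := ENNReal.Tendsto.const_mul (a := ‖c‖ₑ) h2 (Or.inr (by simp))
    rw [mul_zero] at ht
    refine ht.congr fun k => ?_
    rw [← eLpNorm_const_smul]
    congr 1
    ext1 x
    rw [gradient_const_mul c (hψ k).contDiff_one, Pi.smul_apply, smul_sub]

theorem neg (H : IsGradPairZero Ω u g) : IsGradPairZero Ω (fun x => - u x) (fun x => - g x) := by
  simpa using H.const_mul (-1)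

theorem sub (H : IsGradPairZero Ω u g) (H' : IsGradPairZero Ω v h) :
    IsGradPairZero Ω (fun x => u x - v x) (fun x => g x - h x) := by
  simpa only [sub_eq_add_neg] using H.add H'.neg

theorem memH10 (hΩ : IsOpen Ω) (hΩb : Bornology.IsBounded Ω) (H : IsGradPairZero Ω u g) :
    MemH10 Ω u := by
  obtain ⟨ψ, hψ, h1, h2⟩ := (H.congr EventuallyEq.rfl
    (H.isGradPair.weakGradient_ae_eq hΩ hΩb).symm).exists_seq
  exact ⟨H.isGradPair.memH1 hΩb, ψ, hψ, h1, h2⟩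

end IsGradPairZero

theorem MemH10.isGradPairZero (hΩ : IsOpen Ω) (H : MemH10 Ω u) :
    IsGradPairZero Ω u (weakGradient Ω u) :=
  ⟨H.1.1, (H.1.isGradPair hΩ).memLp_grad, H.2⟩

end Pair

/-! ### Closedness and weak compactness of `H¹₀(Ω)`. -/

section WeakCompactness

variable {Ω : Set (EuclideanSpace ℝ (Fin n))} {u : EuclideanSpace ℝ (Fin n) → ℝ}
  {g : EuclideanSpace ℝ (Fin n) → EuclideanSpace ℝ (Fin n)}

theorem IsGradPairZero.exists_testFunction (H : IsGradPairZero Ω u g) {ε : ℝ≥0∞} (hε : 0 < ε) :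
    ∃ ψ, IsTestFunction Ω ψ ∧ eLpNorm (fun x => ψ x - u x) 2 (volume.restrict Ω) ≤ ε ∧
      eLpNorm (fun x => gradient ψ x - g x) 2 (volume.restrict Ω) ≤ ε := by
  obtain ⟨ψ, hψ, h1, h2⟩ := H.exists_seq
  obtain ⟨k, hk1, hk2⟩ := ((h1.eventually_le_const hε).and (h2.eventually_le_const hε)).exists
  exact ⟨ψ k, hψ k, hk1, hk2⟩

/-- A diagonal choice: the `k`-th pair is replaced by a test function within `1/(k+1)` of it. -/
theorem IsGradPairZero.of_tendsto {U : ℕ → EuclideanSpace ℝ (Fin n) → ℝ}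
    {G : ℕ → EuclideanSpace ℝ (Fin n) → EuclideanSpace ℝ (Fin n)}
    (H : ∀ k, IsGradPairZero Ω (U k) (G k)) (hu : MemLp u 2 (volume.restrict Ω))
    (hg : MemLp g 2 (volume.restrict Ω))
    (hU : Tendsto (fun k => eLpNorm (fun x => U k x - u x) 2 (volume.restrict Ω)) atTop (𝓝 0))
    (hG : Tendsto (fun k => eLpNorm (fun x => G k x - g x) 2 (volume.restrict Ω)) atTop (𝓝 0)) :
    IsGradPairZero Ω u g := by
  have hpos : ∀ k : ℕ, (0 : ℝ≥0∞) < ((k : ℝ≥0∞) + 1)⁻¹ := fun k => by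
    simp [ENNReal.inv_pos, ENNReal.add_eq_top]
  have hlim : Tendsto (fun k : ℕ => ((k : ℝ≥0∞) + 1)⁻¹) atTop (𝓝 0) := by
    have := (tendsto_add_atTop_iff_nat 1).2 ENNReal.tendsto_inv_nat_nhds_zero
    simpa using this
  choose ψ hψ h1 h2 using fun k => (H k).exists_testFunction (hpos k)
  refine ⟨hu, hg, ψ, hψ, ?_, ?_⟩
  · have ht := hlim.add hU
    rw [add_zero] at ht
    refine tendsto_eLpNorm_zero_of_le ht fun k => ?_
    have e : (fun x => ψ k x - u x) = (fun x => ψ k x - U k x) + fun x => U k x - u x := by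
      ext x; simp
    rw [e]
    exact (eLpNorm_add_le (((hψ k).memLp 2 Ω).sub (H k).memLp).aestronglyMeasurable
      ((H k).memLp.sub hu).aestronglyMeasurable (by norm_num)).trans (add_le_add_left (h1 k) _)
  · have ht := hlim.add hG
    rw [add_zero] at ht
    refine tendsto_eLpNorm_zero_of_le ht fun k => ?_
    have e : (fun x => gradient (ψ k) x - g x) =
        (fun x => gradient (ψ k) x - G k x) + fun x => G k x - g x := by
      ext1 x; simp
    rw [e]
    exact (eLpNorm_add_le (((hψ k).memLp_gradient 2 Ω).sub (H k).memLp_grad).aestronglyMeasurable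
      ((H k).memLp_grad.sub hg).aestronglyMeasurable (by norm_num)).trans
      (add_le_add_left (h2 k) _)

/-- `H¹₀(Ω)` as a subspace of `L²(Ω) × L²(Ω; ℝⁿ)`. -/
def gradPairZeroSubmodule (Ω : Set (EuclideanSpace ℝ (Fin n))) :
    Submodule ℝ (WithLp 2 (Lp ℝ 2 (volume.restrict Ω) ×
      Lp (EuclideanSpace ℝ (Fin n)) 2 (volume.restrict Ω))) where
  carrier := {x | IsGradPairZero Ω x.fst x.snd}
  add_mem' {x y} hx hy := (hx.add hy).congr (Lp.coeFn_add x.fst y.fst).symm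
    (Lp.coeFn_add x.snd y.snd).symm
  zero_mem' := by
    have e : gradient (fun _ : EuclideanSpace ℝ (Fin n) => (0 : ℝ)) = fun _ => 0 :=
      gradient_fun_const' 0
    have h : IsGradPairZero Ω (fun _ => 0) (fun _ => 0) := e ▸ IsTestFunction.zero.isGradPairZero
    exact h.congr (Lp.coeFn_zero ℝ 2 _).symm (Lp.coeFn_zero (EuclideanSpace ℝ (Fin n)) 2 _).symm
  smul_mem' c x hx := by
    have h1 : (c • x).fst =ᵐ[volume.restrict Ω] fun y => c * x.fst y := Lp.coeFn_smul c x.fst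
    have h2 : (c • x).snd =ᵐ[volume.restrict Ω] fun y => c • x.snd y := Lp.coeFn_smul c x.snd
    exact (IsGradPairZero.const_mul c hx).congr h1.symm h2.symm

theorem isClosed_gradPairZeroSubmodule (Ω : Set (EuclideanSpace ℝ (Fin n))) :
    IsClosed (gradPairZeroSubmodule Ω : Set (WithLp 2 (Lp ℝ 2 (volume.restrict Ω) ×
      Lp (EuclideanSpace ℝ (Fin n)) 2 (volume.restrict Ω)))) := by
  refine IsSeqClosed.isClosed fun x y hx hxy => ?_
  have h1 := (((WithLp.continuous_fst 2 _ _).tendsto y).comp hxy)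
  have h2 := (((WithLp.continuous_snd 2 _ _).tendsto y).comp hxy)
  exact IsGradPairZero.of_tendsto hx (Lp.memLp y.fst) (Lp.memLp y.snd)
    ((Lp.tendsto_Lp_iff_tendsto_eLpNorm' _ _).1 h1) ((Lp.tendsto_Lp_iff_tendsto_eLpNorm' _ _).1 h2)

/-- Bounded sequences in `H¹₀(Ω)` have weakly convergent subsequences. -/
theorem IsGradPairZero.exists_weak_limit {U : ℕ → EuclideanSpace ℝ (Fin n) → ℝ}
    {G : ℕ → EuclideanSpace ℝ (Fin n) → EuclideanSpace ℝ (Fin n)}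
    (H : ∀ k, IsGradPairZero Ω (U k) (G k)) {C : ℝ≥0∞} (hC : C ≠ ⊤)
    (hU : ∀ k, eLpNorm (U k) 2 (volume.restrict Ω) ≤ C)
    (hG : ∀ k, eLpNorm (G k) 2 (volume.restrict Ω) ≤ C) :
    ∃ u g, IsGradPairZero Ω u g ∧ ∃ σ : ℕ → ℕ, StrictMono σ ∧
      (∀ a, MemLp a 2 (volume.restrict Ω) →
        Tendsto (fun k => ∫ x in Ω, a x * U (σ k) x) atTop (𝓝 (∫ x in Ω, a x * u x))) ∧
      (∀ b : EuclideanSpace ℝ (Fin n) → EuclideanSpace ℝ (Fin n), MemLp b 2 (volume.restrict Ω) →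
        Tendsto (fun k => ∫ x in Ω, inner ℝ (G (σ k) x) (b x)) atTop
          (𝓝 (∫ x in Ω, inner ℝ (g x) (b x)))) := by
  have : Fact ((2 : ℝ≥0∞) ≠ ⊤) := ⟨by simp⟩
  have : SecondCountableTopology (Lp ℝ 2 (volume.restrict Ω)) := inferInstance
  have : SecondCountableTopology (Lp (EuclideanSpace ℝ (Fin n)) 2 (volume.restrict Ω)) :=
    inferInstance
  have : SecondCountableTopology (WithLp 2 (Lp ℝ 2 (volume.restrict Ω) ×
      Lp (EuclideanSpace ℝ (Fin n)) 2 (volume.restrict Ω))) := inferInstance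
  let X : ℕ → WithLp 2 (Lp ℝ 2 (volume.restrict Ω) ×
      Lp (EuclideanSpace ℝ (Fin n)) 2 (volume.restrict Ω)) := fun k =>
    WithLp.toLp 2 ((H k).memLp.toLp (U k), (H k).memLp_grad.toLp (G k))
  have hX : ∀ k, X k ∈ gradPairZeroSubmodule Ω := fun k =>
    (H k).congr (H k).memLp.coeFn_toLp.symm (H k).memLp_grad.coeFn_toLp.symm
  -- The product norm is at most `√(C² + C²)`, which is crudely below `2C`.
  have hXC : ∀ k, ‖X k‖ ≤ C.toReal + C.toReal := by
    intro k
    have h1 : ‖(H k).memLp.toLp (U k)‖ ≤ C.toReal := by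
      rw [Lp.norm_toLp]; exact ENNReal.toReal_mono hC (hU k)
    have h2 : ‖(H k).memLp_grad.toLp (G k)‖ ≤ C.toReal := by
      rw [Lp.norm_toLp]; exact ENNReal.toReal_mono hC (hG k)
    refine abs_le_of_sq_le_sq' ?_ (by positivity) |>.2
    rw [WithLp.prod_norm_sq_eq_of_L2]
    have h1' : ‖(X k).fst‖ ^ 2 ≤ C.toReal ^ 2 := pow_le_pow_left₀ (norm_nonneg _) h1 2
    have h2' : ‖(X k).snd‖ ^ 2 ≤ C.toReal ^ 2 := pow_le_pow_left₀ (norm_nonneg _) h2 2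
    nlinarith [ENNReal.toReal_nonneg (a := C)]
  obtain ⟨y, hy, σ, hσ, hlim⟩ := exists_subseq_weak_tendsto (gradPairZeroSubmodule Ω)
    (isClosed_gradPairZeroSubmodule Ω) X hX _ hXC
  refine ⟨y.fst, y.snd, hy, σ, hσ, fun a ha => ?_, fun b hb => ?_⟩
  -- Pairing with `(a, 0)` isolates the functions; pairing with `(0, b)` below isolates the
  -- gradients.
  · have h := hlim (WithLp.toLp 2 (ha.toLp a, 0))
    simp only [WithLp.prod_inner_apply, inner_zero_right, add_zero, L2.inner_def] at h
    have e : ∀ {f v : EuclideanSpace ℝ (Fin n) → ℝ}, f =ᵐ[volume.restrict Ω] v →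
        ∫ x in Ω, inner ℝ (f x) ((ha.toLp a) x) = ∫ x in Ω, a x * v x := by
      intro f v hfv
      refine integral_congr_ae ?_
      filter_upwards [hfv, ha.coeFn_toLp] with x h1 h2
      rw [h1, h2]
      simp
    rw [e (EventuallyEq.refl _ _)] at h
    refine h.congr fun k => ?_
    exact e (H (σ k)).memLp.coeFn_toLp
  · have h := hlim (WithLp.toLp 2 (0, hb.toLp b))
    simp only [WithLp.prod_inner_apply, inner_zero_right, zero_add, L2.inner_def] at h
    have e : ∀ {f v : EuclideanSpace ℝ (Fin n) → EuclideanSpace ℝ (Fin n)},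
        f =ᵐ[volume.restrict Ω] v →
        ∫ x in Ω, inner ℝ (f x) ((hb.toLp b) x) = ∫ x in Ω, inner ℝ (v x) (b x) := by
      intro f v hfv
      refine integral_congr_ae ?_
      filter_upwards [hfv, hb.coeFn_toLp] with x h1 h2
      rw [h1, h2]
    rw [e (EventuallyEq.refl _ _)] at h
    refine h.congr fun k => ?_
    exact e (H (σ k)).memLp_grad.coeFn_toLp

/-- The limit in `L²(Ω)` of a sequence that is bounded in `H¹₀(Ω)` lies in `H¹₀(Ω)`. -/
theorem IsGradPairZero.exists_of_tendsto {U : ℕ → EuclideanSpace ℝ (Fin n) → ℝ}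
    {G : ℕ → EuclideanSpace ℝ (Fin n) → EuclideanSpace ℝ (Fin n)}
    (H : ∀ k, IsGradPairZero Ω (U k) (G k)) {C : ℝ≥0∞} (hC : C ≠ ⊤)
    (hU : ∀ k, eLpNorm (U k) 2 (volume.restrict Ω) ≤ C)
    (hG : ∀ k, eLpNorm (G k) 2 (volume.restrict Ω) ≤ C)
    (hu : MemLp u 2 (volume.restrict Ω))
    (hUu : Tendsto (fun k => eLpNorm (fun x => U k x - u x) 2 (volume.restrict Ω)) atTop (𝓝 0)) :
    ∃ g, IsGradPairZero Ω u g := by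
  obtain ⟨v, g, hvg, σ, hσ, hv, -⟩ := IsGradPairZero.exists_weak_limit H hC hU hG
  refine ⟨g, hvg.congr ?_ EventuallyEq.rfl⟩
  have hd : MemLp (fun x => v x - u x) 2 (volume.restrict Ω) := hvg.memLp.sub hu
  -- The weak limit `v` and the strong limit `u` are both tested against `v - u`, which gives `∫ (v
  -- - u)² = 0`.
  have h1 := hv _ hd
  have h2 := tendsto_integral_smul_of_L2 (fun _ => hd) (fun k => (H (σ k)).memLp) hd hu (by simp)
    (hUu.comp hσ.tendsto_atTop)
  have he := tendsto_nhds_unique h1 h2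
  have h0 : ∫ x in Ω, (v x - u x) * (v x - u x) = 0 := by
    have e : ∀ x, (v x - u x) * (v x - u x) = (v x - u x) • v x - (v x - u x) • u x :=
      fun x => mul_sub _ _ _
    simp only [e]
    rw [integral_sub (integrable_smul_of_memLp_two hd hvg.memLp)
      (integrable_smul_of_memLp_two hd hu), sub_eq_zero]
    exact he
  rw [integral_eq_zero_iff_of_nonneg (fun x => mul_self_nonneg _)
    (integrable_smul_of_memLp_two hd hd)] at h0
  filter_upwards [h0] with x hx
  exact sub_eq_zero.1 (mul_self_eq_zero.1 hx)

end WeakCompactness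

/-! ### Mollification and translation in `L²`. -/

section Mollification

variable {F : Type*} [NormedAddCommGroup F] [NormedSpace ℝ F] [CompleteSpace F]

theorem eLpNorm_two_sq {α G : Type*} [MeasurableSpace α] [NormedAddCommGroup G] (f : α → G)
    (μ : Measure α) : eLpNorm f 2 μ ^ 2 = ∫⁻ x, ‖f x‖ₑ ^ 2 ∂μ := by
  have := eLpNorm_nnreal_pow_eq_lintegral (f := f) (μ := μ) (p := 2) (by norm_num)
  simpa using this

theorem eLpNorm_two_le_iff {α G : Type*} [MeasurableSpace α] [NormedAddCommGroup G] {f : α → G}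
    {μ : Measure α} {B : ℝ≥0∞} : eLpNorm f 2 μ ≤ B ↔ ∫⁻ x, ‖f x‖ₑ ^ 2 ∂μ ≤ B ^ 2 := by
  rw [← eLpNorm_two_sq]
  exact (ENNReal.pow_le_pow_left_iff two_ne_zero).symm

theorem sq_lintegral_le_lintegral_sq {α : Type*} [MeasurableSpace α] {μ : Measure α}
    [IsProbabilityMeasure μ] {a : α → ℝ≥0∞} (ha : AEMeasurable a μ) :
    (∫⁻ x, a x ∂μ) ^ 2 ≤ ∫⁻ x, a x ^ 2 ∂μ := by
  have h := eLpNorm'_le_eLpNorm'_of_exponent_le (p := 1) (q := 2) one_pos one_le_two μ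
    ha.aestronglyMeasurable
  simp only [eLpNorm', enorm_eq_self, ENNReal.rpow_one, div_one, ENNReal.rpow_two] at h
  calc (∫⁻ x, a x ∂μ) ^ 2 ≤ ((∫⁻ x, a x ^ 2 ∂μ) ^ (1 / 2 : ℝ)) ^ 2 := by gcongr
    _ = ∫⁻ x, a x ^ 2 ∂μ := by
      rw [← ENNReal.rpow_natCast, ← ENNReal.rpow_mul]; norm_num

/-- Mollification moves a function in `L²` no further than the translations by vectors in the
support of the mollifier do. -/
theorem eLpNorm_normed_convolution_sub_le (β : ContDiffBump (0 : EuclideanSpace ℝ (Fin n)))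
    {f : EuclideanSpace ℝ (Fin n) → F} (hf : MemLp f 2 volume) {B : ℝ≥0∞}
    (hB : ∀ y ∈ Metric.ball (0 : EuclideanSpace ℝ (Fin n)) β.rOut,
      eLpNorm (fun x => f (x - y) - f x) 2 volume ≤ B) :
    eLpNorm (fun x => (β.normed volume ⋆[ContinuousLinearMap.lsmul ℝ ℝ, volume] f) x - f x) 2
      volume ≤ B := by
  wlog hfm : StronglyMeasurable f generalizing f
  -- A strongly measurable representative makes `(x, y) ↦ f (x - y)` jointly measurable, as Tonelli
  -- requires.
  · have hff := hf.1.ae_eq_mk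
    have h1 := this (hf.ae_eq hff) (fun y hy => ?_) hf.1.stronglyMeasurable_mk
    · rw [← convolution_congr _ (ae_eq_refl _) hff] at h1
      refine le_trans (le_of_eq (eLpNorm_congr_ae ?_)) h1
      filter_upwards [hff] with x hx
      rw [hx]
    · refine le_trans (le_of_eq (eLpNorm_congr_ae ?_)) (hB y hy)
      have hy' := (measurePreserving_sub_right volume y).quasiMeasurePreserving.ae_eq_comp hff
      filter_upwards [hff, hy'] with x hx hx'
      simp only [Function.comp_apply] at hx'
      rw [hx, hx']
  let ρ := β.normed (volume : Measure (EuclideanSpace ℝ (Fin n)))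
  have hρc : Continuous ρ := β.continuous_normed
  have hρm : Measurable fun y => ENNReal.ofReal (ρ y) := hρc.measurable.ennreal_ofReal
  -- The mollifier becomes the density of a probability measure `ν`. The error `ρ ⋆ f - f` is then a
  -- `ν`-average of translation differences, and Jensen followed by Tonelli averages their squared
  -- `L²` norms.
  let ν := (volume : Measure (EuclideanSpace ℝ (Fin n))).withDensity
    fun y => ENNReal.ofReal (ρ y)
  have hν : IsProbabilityMeasure ν := by
    refine ⟨?_⟩
    rw [withDensity_apply _ MeasurableSet.univ, Measure.restrict_univ,
      ← ofReal_integral_eq_lintegral_ofReal β.integrable_normed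
        (Eventually.of_forall β.nonneg_normed), β.integral_normed, ENNReal.ofReal_one]
  have hloc : LocallyIntegrable f volume := hf.locallyIntegrable (by norm_num)
  have hpt : ∀ x, ‖(ρ ⋆[ContinuousLinearMap.lsmul ℝ ℝ, volume] f) x - f x‖ₑ ≤
      ∫⁻ y, ‖f (x - y) - f x‖ₑ ∂ν := by
    intro x
    have hi : Integrable (fun y => ρ y • f (x - y)) :=
      (β.hasCompactSupport_normed.convolutionExists_left (ContinuousLinearMap.lsmul ℝ ℝ) hρc hloc) x
    have hi' : Integrable (fun y => ρ y • f x) := β.integrable_normed.smul_const _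
    have e : (ρ ⋆[ContinuousLinearMap.lsmul ℝ ℝ, volume] f) x - f x =
        ∫ y, ρ y • (f (x - y) - f x) := by
      simp only [smul_sub]
      rw [integral_sub hi hi', integral_smul_const, β.integral_normed, one_smul]
      rfl
    rw [e]
    refine (enorm_integral_le_lintegral_enorm _).trans (le_of_eq ?_)
    rw [lintegral_withDensity_eq_lintegral_mul₀ hρm.aemeasurable]
    · refine lintegral_congr fun y => ?_
      rw [enorm_smul, Pi.mul_apply, Real.enorm_of_nonneg (β.nonneg_normed y)]
    · exact ((hfm.comp_measurable (measurable_const.sub measurable_id)).sub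
        stronglyMeasurable_const).enorm.aemeasurable
  rw [eLpNorm_two_le_iff]
  have hmeas : Measurable (Function.uncurry fun x y : EuclideanSpace ℝ (Fin n) =>
      ‖f (x - y) - f x‖ₑ ^ 2) :=
    (((hfm.comp_measurable (measurable_fst.sub measurable_snd)).sub
      (hfm.comp_measurable measurable_fst)).enorm.pow_const 2)
  calc ∫⁻ x, ‖(ρ ⋆[ContinuousLinearMap.lsmul ℝ ℝ, volume] f) x - f x‖ₑ ^ 2
      ≤ ∫⁻ x, ∫⁻ y, ‖f (x - y) - f x‖ₑ ^ 2 ∂ν := by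
        refine lintegral_mono fun x => (pow_le_pow_left' (hpt x) 2).trans ?_
        refine sq_lintegral_le_lintegral_sq ?_
        exact ((hfm.comp_measurable (measurable_const.sub measurable_id)).sub
          stronglyMeasurable_const).enorm.aemeasurable
    _ = ∫⁻ y, ∫⁻ x, ‖f (x - y) - f x‖ₑ ^ 2 ∂volume ∂ν := lintegral_lintegral_swap hmeas.aemeasurable
    _ ≤ ∫⁻ _, B ^ 2 ∂ν := by
        refine lintegral_mono_ae ?_
        rw [ae_withDensity_iff hρm]
        refine Eventually.of_forall fun y hy => ?_
        rw [← eLpNorm_two_le_iff]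
        refine hB y ?_
        -- Only shifts `y` with nonzero density count, and these lie in the ball of radius `β.rOut`.
        rw [← β.support_normed_eq (μ := volume)]
        intro h0
        exact hy (by simp [ρ, h0])
    _ = B ^ 2 := by simp

/-- Continuity of translations in `L²`, read off from the continuous action of the translation group
on `Lp`. The sign arises because `-y` acts by composition with `x ↦ -y + x`. -/
theorem exists_eLpNorm_translate_sub_le {F : Type*} [NormedAddCommGroup F]
    {f : EuclideanSpace ℝ (Fin n) → F}
    (hf : MemLp f 2 volume) {ε : ℝ≥0∞} (hε : 0 < ε) :
    ∃ δ > 0, ∀ y ∈ Metric.ball (0 : EuclideanSpace ℝ (Fin n)) δ,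
      eLpNorm (fun x => f (x - y) - f x) 2 volume ≤ ε := by
  have : Fact ((2 : ℝ≥0∞) ≠ ⊤) := ⟨by simp⟩
  have hc : Tendsto (fun y : EuclideanSpace ℝ (Fin n) =>
      DomAddAct.mk (-y) +ᵥ hf.toLp f) (𝓝 0) (𝓝 (DomAddAct.mk (-(0 : EuclideanSpace ℝ (Fin n))) +ᵥ hf.toLp f)) := by
    have h1 : Continuous fun y : EuclideanSpace ℝ (Fin n) => DomAddAct.mk (-y) :=
      DomAddAct.continuous_mk.comp continuous_neg
    have h2 : Continuous fun y : EuclideanSpace ℝ (Fin n) => DomAddAct.mk (-y) +ᵥ hf.toLp f :=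
      h1.vadd continuous_const
    exact h2.tendsto 0
  have h0 : DomAddAct.mk (-0 : EuclideanSpace ℝ (Fin n)) +ᵥ hf.toLp f = hf.toLp f := by
    rw [DomAddAct.mk_vadd_toLp]
    simp
  rw [h0] at hc
  simp only [DomAddAct.mk_vadd_toLp] at hc
  rw [Lp.tendsto_Lp_iff_tendsto_eLpNorm''] at hc
  obtain ⟨δ, hδ, h⟩ := Metric.eventually_nhds_iff_ball.1 (hc.eventually_le_const hε)
  refine ⟨δ, hδ, fun y hy => ?_⟩
  have e : (fun x => f (x - y) - f x) = (fun x => f (-y +ᵥ x)) - f := by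
    ext x
    rw [Pi.sub_apply, vadd_eq_add, sub_eq_neg_add x y]
  rw [e]
  exact h y hy

/-- A sequence of mollifiers with shrinking supports. -/
def shrinkingBump (n : ℕ) (k : ℕ) : ContDiffBump (0 : EuclideanSpace ℝ (Fin n)) where
  rIn := 1 / (k + 1) / 2
  rOut := 1 / (k + 1)
  rIn_pos := by positivity
  rIn_lt_rOut := half_lt_self (by positivity)

theorem tendsto_shrinkingBump_rOut (n : ℕ) :
    Tendsto (fun k => (shrinkingBump n k).rOut) atTop (𝓝 0) :=
  tendsto_one_div_add_atTop_nhds_zero_nat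

theorem tendsto_eLpNorm_normed_convolution_sub {f : EuclideanSpace ℝ (Fin n) → F}
    (hf : MemLp f 2 volume) :
    Tendsto (fun k => eLpNorm (fun x => ((shrinkingBump n k).normed volume
      ⋆[ContinuousLinearMap.lsmul ℝ ℝ, volume] f) x - f x) 2 volume) atTop (𝓝 0) := by
  rw [ENNReal.tendsto_atTop_zero]
  intro ε hε
  obtain ⟨δ, hδ, h⟩ := exists_eLpNorm_translate_sub_le hf hε
  obtain ⟨N, hN⟩ := eventually_atTop.1 ((tendsto_shrinkingBump_rOut n).eventually_lt_const hδ)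
  refine ⟨N, fun k hk => eLpNorm_normed_convolution_sub_le _ hf fun y hy => h y ?_⟩
  exact Metric.ball_subset_ball (hN k hk).le hy

/-- The `L²` modulus of continuity of a smooth function is controlled by its gradient. -/
theorem eLpNorm_translate_sub_le {ψ : EuclideanSpace ℝ (Fin n) → ℝ} (hψ : ContDiff ℝ 1 ψ)
    (y : EuclideanSpace ℝ (Fin n)) :
    eLpNorm (fun x => ψ (x - y) - ψ x) 2 volume ≤ ‖y‖ₑ * eLpNorm (gradient ψ) 2 volume := by
  rw [eLpNorm_two_le_iff, mul_pow, eLpNorm_two_sq]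
  have hg := continuous_gradient hψ
  -- The fundamental theorem of calculus on the segment from `x` to `x - y`. Jensen in `t`, Tonelli
  -- and translation invariance then give the bound.
  have hpt : ∀ x, ‖ψ (x - y) - ψ x‖ₑ ≤
      ∫⁻ t in Icc (0 : ℝ) 1, ‖y‖ₑ * ‖gradient ψ (x - t • y)‖ₑ := by
    intro x
    have hd : ∀ t : ℝ, HasDerivAt (fun t : ℝ => ψ (x - t • y))
        (- inner ℝ (gradient ψ (x - t • y)) y) t := by
      intro t
      have h1 : HasDerivAt (fun t : ℝ => x - t • y) (-y) t := by
        simpa using ((hasDerivAt_id t).smul_const y).const_sub x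
      have h2 := (hasGradientAt_of_contDiff hψ (x - t • y)).hasFDerivAt.comp_hasDerivAt t h1
      have e : InnerProductSpace.toDual ℝ _ (gradient ψ (x - t • y)) (-y) =
          - inner ℝ (gradient ψ (x - t • y)) y := by
        rw [InnerProductSpace.toDual_apply_apply, inner_neg_right]
      rw [← e]
      exact h2
    have hcont : Continuous fun t : ℝ => - inner ℝ (gradient ψ (x - t • y)) y := by fun_prop
    have e := intervalIntegral.integral_eq_sub_of_hasDerivAt (a := 0) (b := 1)
      (fun t _ => hd t) (hcont.intervalIntegrable 0 1)
    simp only [one_smul, zero_smul, sub_zero] at e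
    rw [← e, intervalIntegral.integral_of_le zero_le_one, ← integral_Icc_eq_integral_Ioc]
    refine (enorm_integral_le_lintegral_enorm _).trans (lintegral_mono fun t => ?_)
    rw [enorm_neg, mul_comm, ← ofReal_norm, ← ofReal_norm, ← ofReal_norm,
      ← ENNReal.ofReal_mul (norm_nonneg _)]
    exact ENNReal.ofReal_le_ofReal (norm_inner_le_norm _ _)
  have hν : IsProbabilityMeasure (volume.restrict (Icc (0 : ℝ) 1)) := ⟨by simp⟩
  have hmeas : Measurable (Function.uncurry fun (x : EuclideanSpace ℝ (Fin n)) (t : ℝ) =>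
      (‖y‖ₑ * ‖gradient ψ (x - t • y)‖ₑ) ^ 2) := by
    have : Continuous (Function.uncurry fun (x : EuclideanSpace ℝ (Fin n)) (t : ℝ) =>
      gradient ψ (x - t • y)) := by
      simp only [Function.uncurry_def]
      fun_prop
    exact (this.measurable.enorm.const_mul _).pow_const 2
  calc ∫⁻ x, ‖ψ (x - y) - ψ x‖ₑ ^ 2
      ≤ ∫⁻ x, ∫⁻ t in Icc (0 : ℝ) 1, (‖y‖ₑ * ‖gradient ψ (x - t • y)‖ₑ) ^ 2 := by
        refine lintegral_mono fun x => (pow_le_pow_left' (hpt x) 2).trans ?_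
        refine sq_lintegral_le_lintegral_sq ?_
        have : Continuous fun t : ℝ => gradient ψ (x - t • y) := by fun_prop
        exact (this.measurable.enorm.const_mul _).aemeasurable
    _ = ∫⁻ t in Icc (0 : ℝ) 1, ∫⁻ x, (‖y‖ₑ * ‖gradient ψ (x - t • y)‖ₑ) ^ 2 :=
        lintegral_lintegral_swap hmeas.aemeasurable
    _ = ∫⁻ t in Icc (0 : ℝ) 1, ‖y‖ₑ ^ 2 * ∫⁻ x, ‖gradient ψ x‖ₑ ^ 2 := by
        refine lintegral_congr fun t => ?_
        simp only [mul_pow]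
        rw [lintegral_const_mul' _ _ (by simp),
          lintegral_sub_right_eq_self (fun x => ‖gradient ψ x‖ₑ ^ 2)]
    _ = ‖y‖ₑ ^ 2 * ∫⁻ x, ‖gradient ψ x‖ₑ ^ 2 := by simp

end Mollification

/-! ### Poincaré's inequality and Rellich's theorem. -/

section Compactness

variable {Ω : Set (EuclideanSpace ℝ (Fin n))}

theorem IsTestFunction.eLpNorm_gradient_eq {ψ : EuclideanSpace ℝ (Fin n) → ℝ}
    (hψ : IsTestFunction Ω ψ) :
    eLpNorm (gradient ψ) 2 (volume.restrict Ω) = eLpNorm (gradient ψ) 2 volume := by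
  refine eLpNorm_restrict_eq_of_support_subset fun x hx => ?_
  by_contra hxΩ
  exact hx (hψ.gradient_eq_zero hxΩ)

theorem eLpNorm_le_add_eLpNorm_sub {α G : Type*} [MeasurableSpace α] [NormedAddCommGroup G]
    {μ : Measure α} {f g : α → G} (hf : AEStronglyMeasurable f μ) (hg : AEStronglyMeasurable g μ) :
    eLpNorm f 2 μ ≤ eLpNorm g 2 μ + eLpNorm (fun x => f x - g x) 2 μ := by
  have e : f = g + fun x => f x - g x := by ext x; simp
  calc eLpNorm f 2 μ = eLpNorm (g + fun x => f x - g x) 2 μ := by rw [← e]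
    _ ≤ _ := eLpNorm_add_le hg (hf.sub hg) (by norm_num)

theorem eLpNorm_sub_le_add {α G : Type*} [MeasurableSpace α] [NormedAddCommGroup G]
    {μ : Measure α} {f g h : α → G} (hf : AEStronglyMeasurable f μ)
    (hg : AEStronglyMeasurable g μ) (hh : AEStronglyMeasurable h μ) :
    eLpNorm (fun x => f x - h x) 2 μ ≤
      eLpNorm (fun x => f x - g x) 2 μ + eLpNorm (fun x => g x - h x) 2 μ := by
  have e : (fun x => f x - h x) = (fun x => f x - g x) + fun x => g x - h x := by ext x; simp
  rw [e]
  exact eLpNorm_add_le (hf.sub hg) (hg.sub hh) (by norm_num)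

theorem eLpNorm_sub_swap {α G : Type*} [MeasurableSpace α] [NormedAddCommGroup G]
    {μ : Measure α} (f g : α → G) (p : ℝ≥0∞) :
    eLpNorm (fun x => f x - g x) p μ = eLpNorm (fun x => g x - f x) p μ :=
  eLpNorm_sub_comm f g p μ

/-- **Poincaré's inequality** on `H¹₀(Ω)`. -/
theorem exists_poincare_const (hn : 1 ≤ n) (hΩ : MeasurableSet Ω)
    (hΩb : Bornology.IsBounded Ω) :
    ∃ C : ℝ≥0∞, C ≠ ⊤ ∧ ∀ u g, IsGradPairZero Ω u g →
      eLpNorm u 2 (volume.restrict Ω) ≤ C * eLpNorm g 2 (volume.restrict Ω) := by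
  obtain ⟨R, hR, hΩR⟩ := hΩb.subset_ball_lt 0 0
  -- A shift of length `2R` moves `Ω ⊆ B_R` off itself. So `ψ (x - y) = 0` on `Ω`, and `ψ` there is,
  -- up to sign, a translation difference, of norm at most `2R ‖Dψ‖`.
  let y : EuclideanSpace ℝ (Fin n) := EuclideanSpace.single ⟨0, hn⟩ (2 * R)
  have hy : ‖y‖ = 2 * R := by simp [y, abs_of_pos hR]
  have htest : ∀ ψ, IsTestFunction Ω ψ → eLpNorm ψ 2 (volume.restrict Ω) ≤
      ‖y‖ₑ * eLpNorm (gradient ψ) 2 (volume.restrict Ω) := by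
    intro ψ hψ
    have hΩ0 : ∀ x ∈ Ω, ψ (x - y) = 0 := by
      intro x hx
      refine hψ.eq_zero fun hxy => ?_
      have h1 := mem_ball_zero_iff.1 (hΩR hx)
      have h2 := mem_ball_zero_iff.1 (hΩR hxy)
      have h3 : ‖y‖ ≤ ‖x‖ + ‖x - y‖ := by
        have := norm_sub_le x (x - y)
        rwa [sub_sub_cancel] at this
      linarith
    rw [hψ.eLpNorm_gradient_eq]
    refine le_trans ?_ (eLpNorm_translate_sub_le hψ.contDiff_one y)
    refine le_trans (eLpNorm_mono_ae ?_) (eLpNorm_restrict_le _ _ _ Ω)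
    filter_upwards [ae_restrict_mem hΩ] with x hx
    rw [hΩ0 x hx, zero_sub, norm_neg]
  refine ⟨‖y‖ₑ, by simp, fun u g H => ?_⟩
  obtain ⟨ψ, hψ, h1, h2⟩ := H.exists_seq
  have hk : ∀ k, eLpNorm u 2 (volume.restrict Ω) ≤
      ‖y‖ₑ * (eLpNorm g 2 (volume.restrict Ω) +
        eLpNorm (fun x => gradient (ψ k) x - g x) 2 (volume.restrict Ω)) +
      eLpNorm (fun x => ψ k x - u x) 2 (volume.restrict Ω) := by
    intro k
    rw [eLpNorm_sub_swap (ψ k) u]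
    refine (eLpNorm_le_add_eLpNorm_sub H.memLp.1 ((hψ k).memLp 2 Ω).1).trans ?_
    gcongr
    refine (htest _ (hψ k)).trans ?_
    gcongr
    exact eLpNorm_le_add_eLpNorm_sub ((hψ k).memLp_gradient 2 Ω).1 H.memLp_grad.1
  refine ge_of_tendsto' (x := atTop) ?_ hk
  have ht := (ENNReal.Tendsto.const_mul (a := ‖y‖ₑ)
    (tendsto_const_nhds (x := eLpNorm g 2 (volume.restrict Ω)) |>.add h2)
    (Or.inr (by simp))).add h1
  rwa [add_zero, add_zero] at ht

theorem normed_convolution_indicator_apply (β : ContDiffBump (0 : EuclideanSpace ℝ (Fin n)))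
    (hΩ : MeasurableSet Ω) (v : EuclideanSpace ℝ (Fin n) → ℝ) (x : EuclideanSpace ℝ (Fin n)) :
    (β.normed volume ⋆[ContinuousLinearMap.lsmul ℝ ℝ, volume] Ω.indicator v) x =
      ∫ y in Ω, β.normed volume (x - y) * v y := by
  rw [convolution_eq_swap, ← integral_indicator hΩ]
  refine integral_congr_ae (Eventually.of_forall fun y => ?_)
  by_cases hy : y ∈ Ω <;> simp [hy]

theorem continuous_normed_convolution_indicator
    (β : ContDiffBump (0 : EuclideanSpace ℝ (Fin n))) (hΩ : MeasurableSet Ω)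
    {v : EuclideanSpace ℝ (Fin n) → ℝ} (hv : MemLp v 2 (volume.restrict Ω)) :
    Continuous (β.normed volume ⋆[ContinuousLinearMap.lsmul ℝ ℝ, volume] Ω.indicator v) :=
  (β.hasCompactSupport_normed.contDiff_convolution_left (n := 0) _ (β.contDiff_normed)
    (((memLp_indicator_iff_restrict hΩ).2 hv).locallyIntegrable (by norm_num))).continuous

theorem memLp_normed_sub (β : ContDiffBump (0 : EuclideanSpace ℝ (Fin n)))
    (x : EuclideanSpace ℝ (Fin n)) (s : Set (EuclideanSpace ℝ (Fin n))) :
    MemLp (fun y => β.normed volume (x - y)) 2 (volume.restrict s) :=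
  ((β.continuous_normed.memLp_of_hasCompactSupport
    β.hasCompactSupport_normed).comp_measurePreserving
    (Measure.measurePreserving_sub_left volume x)).restrict s

/-- Cauchy–Schwarz. The bound does not depend on `x`, so it serves as the majorant for dominated
convergence on `Ω`. -/
theorem enorm_normed_convolution_indicator_le
    (β : ContDiffBump (0 : EuclideanSpace ℝ (Fin n))) (hΩ : MeasurableSet Ω)
    {v : EuclideanSpace ℝ (Fin n) → ℝ} (hv : MemLp v 2 (volume.restrict Ω))
    (x : EuclideanSpace ℝ (Fin n)) :
    ‖(β.normed volume ⋆[ContinuousLinearMap.lsmul ℝ ℝ, volume] Ω.indicator v) x‖ₑ ≤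
      eLpNorm (β.normed volume) 2 volume * eLpNorm v 2 (volume.restrict Ω) := by
  rw [normed_convolution_indicator_apply β hΩ]
  refine (enorm_integral_le_lintegral_enorm _).trans ?_
  rw [← eLpNorm_one_eq_lintegral_enorm]
  refine (eLpNorm_smul_one_le (memLp_normed_sub β x Ω).1 hv.1).trans ?_
  gcongr
  have hc := (β.continuous_normed (μ := volume)).aestronglyMeasurable (μ := volume)
  exact (eLpNorm_restrict_le _ _ _ _).trans
    (eLpNorm_comp_measurePreserving hc (Measure.measurePreserving_sub_left volume x)).le

/-- Mollification turns weak convergence in `L²` into strong convergence. -/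
theorem tendsto_eLpNorm_normed_convolution_of_weak
    (β : ContDiffBump (0 : EuclideanSpace ℝ (Fin n)))
    (hΩ : MeasurableSet Ω) (hΩb : Bornology.IsBounded Ω)
    {V : ℕ → EuclideanSpace ℝ (Fin n) → ℝ} (hV : ∀ k, MemLp (V k) 2 (volume.restrict Ω))
    {C : ℝ≥0∞} (hC : C ≠ ⊤) (hVC : ∀ k, eLpNorm (V k) 2 (volume.restrict Ω) ≤ C)
    (hw : ∀ a, MemLp a 2 (volume.restrict Ω) →
        Tendsto (fun k => ∫ x in Ω, a x * V k x) atTop (𝓝 0)) :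
    Tendsto (fun k => eLpNorm (β.normed volume ⋆[ContinuousLinearMap.lsmul ℝ ℝ, volume]
      Ω.indicator (V k)) 2 (volume.restrict Ω)) atTop (𝓝 0) := by
  have : IsFiniteMeasure (volume.restrict Ω) := ⟨by simpa using hΩb.measure_lt_top⟩
  -- At a fixed `x` the mollification is the integral of `V k` against the fixed `L²` function `ρ (x
  -- - ·)`, so weak convergence gives pointwise convergence.
  have hpt : ∀ x, Tendsto (fun k => (β.normed volume ⋆[ContinuousLinearMap.lsmul ℝ ℝ, volume]
      Ω.indicator (V k)) x) atTop (𝓝 0) := by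
    intro x
    refine (hw _ (memLp_normed_sub β x Ω)).congr fun k => ?_
    rw [normed_convolution_indicator_apply β hΩ]
  have hfin : eLpNorm (β.normed volume) 2 volume * C ≠ ⊤ :=
    ENNReal.mul_ne_top (β.continuous_normed.memLp_of_hasCompactSupport
      β.hasCompactSupport_normed).2.ne hC
  have hlim := tendsto_lintegral_of_dominated_convergence (μ := volume.restrict Ω)
    (F := fun k x => ‖(β.normed volume ⋆[ContinuousLinearMap.lsmul ℝ ℝ, volume]
      Ω.indicator (V k)) x‖ₑ ^ 2)
    (f := fun _ => 0) (fun _ => (eLpNorm (β.normed volume) 2 volume * C) ^ 2)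
    (fun k => (continuous_normed_convolution_indicator β hΩ (hV k)).measurable.enorm.pow_const 2)
    (fun k => Eventually.of_forall fun x => pow_le_pow_left'
      ((enorm_normed_convolution_indicator_le β hΩ (hV k) x).trans
        (mul_le_mul_right (hVC k) _)) 2)
    (by
      rw [lintegral_const]
      exact ENNReal.mul_ne_top (ENNReal.pow_ne_top hfin) (measure_ne_top _ _))
    (Eventually.of_forall fun x => by
      have := (ENNReal.continuous_pow 2).tendsto _ |>.comp (hpt x).enorm
      simpa [Function.comp_def] using this)
  simp only [← eLpNorm_two_sq, lintegral_zero] at hlim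
  rw [ENNReal.tendsto_atTop_zero] at hlim ⊢
  intro ε hε
  obtain ⟨N, hN⟩ := hlim (ε ^ 2) (by positivity)
  exact ⟨N, fun k hk => (ENNReal.pow_le_pow_left_iff two_ne_zero).1 (hN k hk)⟩

/-- **Rellich's theorem**: weak convergence in `H¹₀(Ω)` implies strong convergence in `L²(Ω)`. -/
theorem IsGradPairZero.tendsto_of_weak (hΩ : IsOpen Ω) (hΩb : Bornology.IsBounded Ω)
    {U : ℕ → EuclideanSpace ℝ (Fin n) → ℝ} {u : EuclideanSpace ℝ (Fin n) → ℝ}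
    {G : ℕ → EuclideanSpace ℝ (Fin n) → EuclideanSpace ℝ (Fin n)}
    (H : ∀ k, IsGradPairZero Ω (U k) (G k)) {C : ℝ≥0∞} (hC : C ≠ ⊤)
    (hU : ∀ k, eLpNorm (U k) 2 (volume.restrict Ω) ≤ C)
    (hG : ∀ k, eLpNorm (G k) 2 (volume.restrict Ω) ≤ C)
    (hu : MemLp u 2 (volume.restrict Ω))
    (hw : ∀ a, MemLp a 2 (volume.restrict Ω) →
        Tendsto (fun k => ∫ x in Ω, a x * U k x) atTop (𝓝 (∫ x in Ω, a x * u x))) :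
    Tendsto (fun k => eLpNorm (fun x => U k x - u x) 2 (volume.restrict Ω)) atTop (𝓝 0) := by
  rw [ENNReal.tendsto_atTop_zero]
  intro ε hε
  -- The passage from `U k` to `u` goes through `ψ k`, `T (ψ k)` and `T u`, where `T` is a
  -- mollification; each of the four errors is at most `η`.
  obtain ⟨η, hη, hηε⟩ : ∃ η : ℝ≥0∞, 0 < η ∧ η + η + (η + η) ≤ ε := by
    refine ⟨ε / 2 / 2, ENNReal.div_pos (ENNReal.div_pos hε.ne' (by simp)).ne' (by simp),
      le_of_eq ?_⟩
    rw [ENNReal.add_halves, ENNReal.add_halves]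
  have hpos : ∀ k : ℕ, (0 : ℝ≥0∞) < ((k : ℝ≥0∞) + 1)⁻¹ := fun k => by
    simp [ENNReal.inv_pos, ENNReal.add_eq_top]
  have hle1 : ∀ k : ℕ, ((k : ℝ≥0∞) + 1)⁻¹ ≤ 1 := fun k => by
    rw [ENNReal.inv_le_one]; exact le_add_self
  have hlim : Tendsto (fun k : ℕ => ((k : ℝ≥0∞) + 1)⁻¹) atTop (𝓝 0) := by
    have := (tendsto_add_atTop_iff_nat 1).2 ENNReal.tendsto_inv_nat_nhds_zero
    simpa using this
  choose ψ hψ h1 h2 using fun k => (H k).exists_testFunction (hpos k)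
  have hũ : MemLp (Ω.indicator u) 2 volume := (memLp_indicator_iff_restrict hΩ.measurableSet).2 hu
  -- The mollifier is fixed before `k`: `C + 1` bounds `‖D(ψ k)‖` for all `k`, so one radius makes
  -- `T (ψ k) - ψ k` uniformly small.
  obtain ⟨j, hj1, hj2⟩ : ∃ j, eLpNorm (fun x => ((shrinkingBump n j).normed volume
      ⋆[ContinuousLinearMap.lsmul ℝ ℝ, volume] Ω.indicator u) x - Ω.indicator u x) 2 volume ≤ η ∧
      ENNReal.ofReal ((shrinkingBump n j).rOut) * (C + 1) ≤ η := by
    have ht : Tendsto (fun j => ENNReal.ofReal ((shrinkingBump n j).rOut) * (C + 1)) atTop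
        (𝓝 0) := by
      have := ENNReal.Tendsto.mul_const (b := C + 1)
        (ENNReal.tendsto_ofReal (tendsto_shrinkingBump_rOut n)) (Or.inr (by simp [hC]))
      simpa using this
    exact (((tendsto_eLpNorm_normed_convolution_sub hũ).eventually_le_const hη).and
      (ht.eventually_le_const hη)).exists
  set β := shrinkingBump n j
  let T : (EuclideanSpace ℝ (Fin n) → ℝ) → EuclideanSpace ℝ (Fin n) → ℝ := fun v =>
    β.normed volume ⋆[ContinuousLinearMap.lsmul ℝ ℝ, volume] Ω.indicator v
  have hTc : ∀ v, MemLp v 2 (volume.restrict Ω) → Continuous (T v) := fun v hv =>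
    continuous_normed_convolution_indicator β hΩ.measurableSet hv
  have hψL : ∀ k, MemLp (ψ k) 2 (volume.restrict Ω) := fun k => (hψ k).memLp 2 Ω
  have hψT : ∀ k, eLpNorm (fun x => T (ψ k) x - ψ k x) 2 (volume.restrict Ω) ≤ η := by
    intro k
    have e : Ω.indicator (ψ k) = ψ k := by
      rw [indicator_eq_self]
      intro x hx
      by_contra hxΩ
      exact hx ((hψ k).eq_zero hxΩ)
    have hL : MemLp (ψ k) 2 volume := by
      rw [← e]; exact (memLp_indicator_iff_restrict hΩ.measurableSet).2 (hψL k)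
    simp only [T, e]
    refine (eLpNorm_restrict_le _ _ _ _).trans
      (eLpNorm_normed_convolution_sub_le β hL fun y hy => ?_)
    refine (eLpNorm_translate_sub_le (hψ k).contDiff_one y).trans (le_trans ?_ hj2)
    gcongr
    · rw [← ofReal_norm]
      exact ENNReal.ofReal_le_ofReal (mem_ball_zero_iff.1 hy).le
    · rw [← (hψ k).eLpNorm_gradient_eq]
      refine (eLpNorm_le_add_eLpNorm_sub ((hψ k).memLp_gradient 2 Ω).1 (H k).memLp_grad.1).trans ?_
      gcongr
      · exact hG k
      · exact (h2 k).trans (hle1 k)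
  have h1' : Tendsto (fun k => eLpNorm (fun x => ψ k x - U k x) 2 (volume.restrict Ω)) atTop (𝓝 0) :=
    tendsto_eLpNorm_zero_of_le hlim h1
  have hV : ∀ k, MemLp (fun x => ψ k x - u x) 2 (volume.restrict Ω) := fun k => (hψL k).sub hu
  -- With `T` fixed, `ψ k - u` tends weakly to `0`, since `ψ k - U k` does so strongly and `U k - u`
  -- weakly.
  have hTV : Tendsto (fun k => eLpNorm (T fun x => ψ k x - u x) 2 (volume.restrict Ω)) atTop (𝓝 0) := by
    refine tendsto_eLpNorm_normed_convolution_of_weak β hΩ.measurableSet hΩb hV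
      (C := 1 + C + eLpNorm u 2 (volume.restrict Ω)) (by simp [hC, hu.2.ne]) (fun k => ?_) fun a ha => ?_
    · refine (eLpNorm_sub_le (hψL k).1 hu.1 (by norm_num)).trans ?_
      gcongr
      refine (eLpNorm_le_add_eLpNorm_sub (hψL k).1 (H k).memLp.1).trans ?_
      rw [add_comm]
      exact add_le_add ((h1 k).trans (hle1 k)) (hU k)
    · have hψU : ∀ k, MemLp (fun x => ψ k x - U k x) 2 (volume.restrict Ω) := fun k => (hψL k).sub (H k).memLp
      have t1 := tendsto_integral_smul_of_L2 (h := fun _ => (0 : ℝ)) (fun _ => ha) hψU ha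
        MemLp.zero' (by simp) (by simpa using h1')
      have t2 := (t1.add (hw a ha)).sub_const (∫ x in Ω, a x * u x)
      simp only [smul_zero, integral_zero, zero_add, sub_self] at t2
      refine t2.congr fun k => ?_
      have i1 : Integrable (fun x => a x • (ψ k x - U k x)) (volume.restrict Ω) :=
        integrable_smul_of_memLp_two ha (hψU k)
      have i2 : Integrable (fun x => a x * U k x) (volume.restrict Ω) :=
        integrable_smul_of_memLp_two ha (H k).memLp
      have i3 : Integrable (fun x => a x * u x) (volume.restrict Ω) := integrable_smul_of_memLp_two ha hu
      have i4 : Integrable (fun x => a x • (ψ k x - U k x) + a x * U k x)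
        (volume.restrict Ω) := i1.add i2
      rw [← integral_add i1 i2, ← integral_sub i4 i3]
      refine integral_congr_ae (Eventually.of_forall fun x => ?_)
      simp only [smul_eq_mul]
      ring
  obtain ⟨N, hN⟩ := eventually_atTop.1
    ((h1'.eventually_le_const hη).and (hTV.eventually_le_const hη))
  refine ⟨N, fun k hk => le_trans ?_ hηε⟩
  obtain ⟨hk1, hk2⟩ := hN k hk
  have hTe : ∀ x, T (ψ k) x - T u x = T (fun x => ψ k x - u x) x := by
    intro x
    simp only [T, normed_convolution_indicator_apply β hΩ.measurableSet]
    have hρx := memLp_normed_sub β x Ω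
    have i1 : Integrable (fun y => β.normed volume (x - y) * ψ k y) (volume.restrict Ω) :=
      integrable_smul_of_memLp_two hρx (hψL k)
    have i2 : Integrable (fun y => β.normed volume (x - y) * u y) (volume.restrict Ω) :=
      integrable_smul_of_memLp_two hρx hu
    rw [← integral_sub i1 i2]
    simp only [mul_sub]
  have m1 := (hTc _ (hψL k)).aestronglyMeasurable (μ := volume.restrict Ω)
  have m2 := (hTc _ hu).aestronglyMeasurable (μ := volume.restrict Ω)
  refine (eLpNorm_sub_le_add (H k).memLp.1 m1 hu.1).trans (add_le_add ?_ ?_)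
  · refine (eLpNorm_sub_le_add (H k).memLp.1 (hψL k).1 m1).trans (add_le_add ?_ ?_)
    · rw [eLpNorm_sub_swap]; exact hk1
    · rw [eLpNorm_sub_swap]; exact hψT k
  · refine (eLpNorm_sub_le_add m1 m2 hu.1).trans (add_le_add ?_ ?_)
    · simp only [hTe]; exact hk2
    · refine le_trans (le_of_eq (eLpNorm_congr_ae ?_)) ((eLpNorm_restrict_le _ _ _ Ω).trans hj1)
      filter_upwards [ae_restrict_mem hΩ.measurableSet] with x hx
      rw [indicator_of_mem hx]

end Compactness

/-! ### Cutoff functions and localization into `H¹₀(Ω)`. -/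

section Cutoff

variable {Ω : Set (EuclideanSpace ℝ (Fin n))}

/-- Being `1` in a neighbourhood of `K`, and not merely on `K`, makes the gradient of `χ` vanish on
`K`. -/
theorem exists_cutoff {K : Set (EuclideanSpace ℝ (Fin n))} (hK : IsCompact K) (hΩ : IsOpen Ω)
    (hKΩ : K ⊆ Ω) : ∃ χ, IsTestFunction Ω χ ∧ (∀ x ∈ K, χ =ᶠ[𝓝 x] fun _ => 1) ∧
      ∀ x, χ x ∈ Icc (0 : ℝ) 1 := by
  obtain ⟨δ, hδ, hδΩ⟩ := hK.exists_cthickening_subset_open hΩ hKΩ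
  have hint : K ⊆ interior (Metric.cthickening δ K) :=
    (Metric.self_subset_thickening hδ K).trans
      (interior_maximal (Metric.thickening_subset_cthickening δ K) Metric.isOpen_thickening)
  obtain ⟨χ, h1, h0, h01⟩ := exists_contMDiffMap_one_nhds_of_subset_interior (n := ⊤)
    (modelWithCornersSelf ℝ (EuclideanSpace ℝ (Fin n))) hK.isClosed hint
  have hsupp : tsupport χ ⊆ Metric.cthickening δ K := by
    refine closure_minimal (fun x hx => ?_) Metric.isClosed_cthickening
    by_contra hx'
    exact hx (h0 x hx')
  refine ⟨χ, ⟨χ.contMDiff.contDiff, ?_, hsupp.trans hδΩ⟩, fun x hx => ?_, h01⟩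
  · exact HasCompactSupport.intro hK.cthickening fun x hx => h0 x hx
  · exact eventually_nhdsSet_iff_forall.1 h1 x hx

theorem memLp_continuous_compactSupport_smul {F : Type*} [NormedAddCommGroup F] [NormedSpace ℝ F]
    {μ : Measure (EuclideanSpace ℝ (Fin n))} [IsFiniteMeasureOnCompacts μ]
    {χ : EuclideanSpace ℝ (Fin n) → ℝ} (hχ : Continuous χ) (hc : HasCompactSupport χ)
    {g : EuclideanSpace ℝ (Fin n) → F} (hg : MemLp g 2 μ) : MemLp (fun x => χ x • g x) 2 μ :=
  MemLp.smul (p := ⊤) (q := 2) hg (hχ.memLp_of_hasCompactSupport hc)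

theorem memLp_smul_continuous_compactSupport {F : Type*} [NormedAddCommGroup F] [NormedSpace ℝ F]
    {μ : Measure (EuclideanSpace ℝ (Fin n))} [IsFiniteMeasureOnCompacts μ]
    {χ : EuclideanSpace ℝ (Fin n) → F} (hχ : Continuous χ) (hc : HasCompactSupport χ)
    {v : EuclideanSpace ℝ (Fin n) → ℝ} (hv : MemLp v 2 μ) : MemLp (fun x => v x • χ x) 2 μ :=
  MemLp.smul (p := 2) (q := ⊤) (hχ.memLp_of_hasCompactSupport hc) hv

/-- The product rule for a smooth function with compact support, tested against smooth functions
without compact support. -/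
theorem IsGradPair.integral_cutoff_eq {v : EuclideanSpace ℝ (Fin n) → ℝ}
    {g : EuclideanSpace ℝ (Fin n) → EuclideanSpace ℝ (Fin n)} (H : IsGradPair Ω v g)
    {χ η : EuclideanSpace ℝ (Fin n) → ℝ} (hχ : IsTestFunction Ω χ) (hη : ContDiff ℝ ∞ η) :
    ∫ x in Ω, (χ x * v x) • gradient η x =
      - ∫ x in Ω, η x • (χ x • g x + v x • gradient χ x) := by
  have hη1 : ContDiff ℝ 1 η := hη.of_le (by exact_mod_cast le_top)
  -- `η` itself need not be admissible, but `η χ` is.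
  have hηχ : IsTestFunction Ω (fun x => η x * χ x) := hχ.contDiff_mul hη
  have h := H.integral_eq _ hηχ
  have e1 : ∀ x, v x • gradient (fun x => η x * χ x) x =
      (χ x * v x) • gradient η x + v x • (η x • gradient χ x) := by
    intro x
    rw [gradient_mul hη1 hχ.contDiff_one]
    module
  have e2 : ∀ x, η x • (χ x • g x + v x • gradient χ x) =
      (η x * χ x) • g x + v x • (η x • gradient χ x) := fun x => by module
  have c1 : MemLp (fun x => η x • gradient χ x) 2 (volume.restrict Ω) :=
    ((hη.continuous.smul (continuous_gradient hχ.contDiff_one)).memLp_of_hasCompactSupport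
      (hasCompactSupport_gradient hχ.hasCompactSupport).smul_left).restrict Ω
  have c2 : MemLp (fun x => χ x • gradient η x) 2 (volume.restrict Ω) :=
    ((hχ.contDiff.continuous.smul (continuous_gradient hη1)).memLp_of_hasCompactSupport
      hχ.hasCompactSupport.smul_right).restrict Ω
  have i1 : Integrable (fun x => v x • (η x • gradient χ x)) (volume.restrict Ω) :=
    integrable_smul_of_memLp_two H.memLp c1
  have i2 : Integrable (fun x => (χ x * v x) • gradient η x) (volume.restrict Ω) := by
    refine (integrable_smul_of_memLp_two H.memLp c2).congr (Eventually.of_forall fun x => ?_)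
    simp only
    module
  have i3 : Integrable (fun x => (η x * χ x) • g x) (volume.restrict Ω) :=
    integrable_smul_of_memLp_two (hηχ.memLp 2 Ω) H.memLp_grad
  simp only [e1] at h
  simp only [e2]
  rw [integral_add i2 i1] at h
  rw [integral_add i3 i1, neg_add, ← h]
  abel

theorem gradient_comp_const_sub {ρ : EuclideanSpace ℝ (Fin n) → ℝ} (hρ : ContDiff ℝ 1 ρ)
    (x y : EuclideanSpace ℝ (Fin n)) :
    gradient (fun y => ρ (x - y)) y = - gradient ρ (x - y) := by
  refine HasGradientAt.gradient ?_
  rw [hasGradientAt_iff_hasFDerivAt, map_neg]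
  have h1 : HasFDerivAt (fun y => x - y) (-ContinuousLinearMap.id ℝ (EuclideanSpace ℝ (Fin n))) y :=
    (hasFDerivAt_id y).const_sub x
  have h2 := (hasGradientAt_of_contDiff hρ (x - y)).hasFDerivAt.comp y h1
  have e : -fderiv ℝ ρ (x - y) = (fderiv ℝ ρ (x - y)).comp
      (-ContinuousLinearMap.id ℝ (EuclideanSpace ℝ (Fin n))) := by
    ext; simp
  rw [toDual_gradient, e, ← toDual_gradient]
  exact h2

theorem integrable_smul_gradient_sub {ρ : EuclideanSpace ℝ (Fin n) → ℝ} (hρ : ContDiff ℝ 1 ρ)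
    (hc : HasCompactSupport ρ) {f : EuclideanSpace ℝ (Fin n) → ℝ}
    (hf : LocallyIntegrable f volume) (x : EuclideanSpace ℝ (Fin n)) :
    Integrable fun y => f y • gradient ρ (x - y) := by
  have h := ((hasCompactSupport_gradient hc).convolutionExists_left
    (ContinuousLinearMap.lsmul ℝ ℝ).flip (continuous_gradient hρ) hf x).integrable_swap
  simpa only [ContinuousLinearMap.flip_apply, ContinuousLinearMap.lsmul_apply] using h

/-- The gradient of a mollification, with the derivative on the mollifier. -/
theorem gradient_convolution {ρ : EuclideanSpace ℝ (Fin n) → ℝ} (hρ : ContDiff ℝ 1 ρ)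
    (hc : HasCompactSupport ρ) {f : EuclideanSpace ℝ (Fin n) → ℝ}
    (hf : LocallyIntegrable f volume) (x : EuclideanSpace ℝ (Fin n)) :
    gradient (ρ ⋆[ContinuousLinearMap.lsmul ℝ ℝ, volume] f) x =
      ∫ y, f y • gradient ρ (x - y) := by
  refine ext_inner_right ℝ fun e => ?_
  rw [inner_gradient_left, (hc.hasFDerivAt_convolution_left (ContinuousLinearMap.lsmul ℝ ℝ)
    hρ hf x).fderiv, real_inner_comm, ← integral_inner (integrable_smul_gradient_sub hρ hc hf x)]
  have i1 := ((hc.fderiv ℝ).convolutionExists_left (ContinuousLinearMap.precompL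
    (EuclideanSpace ℝ (Fin n)) (ContinuousLinearMap.lsmul ℝ ℝ : ℝ →L[ℝ] ℝ →L[ℝ] ℝ))
    (hρ.continuous_fderiv one_ne_zero) hf x).integrable_swap
  rw [convolution_eq_swap, ContinuousLinearMap.integral_apply i1]
  refine integral_congr_ae (Eventually.of_forall fun y => ?_)
  simp only [ContinuousLinearMap.precompL_apply, ContinuousLinearMap.lsmul_apply, smul_eq_mul,
    real_inner_smul_right, inner_gradient_right, conj_trivial]
  ring

/-- A function in `H¹(Ω)` multiplied by a smooth cutoff lies in `H¹₀(Ω)`. -/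
theorem IsGradPair.cutoff (hΩ : IsOpen Ω) {v : EuclideanSpace ℝ (Fin n) → ℝ}
    {g : EuclideanSpace ℝ (Fin n) → EuclideanSpace ℝ (Fin n)} (H : IsGradPair Ω v g)
    {χ : EuclideanSpace ℝ (Fin n) → ℝ} (hχ : IsTestFunction Ω χ) :
    IsGradPairZero Ω (fun x => χ x * v x) (fun x => χ x • g x + v x • gradient χ x) := by
  have hf : MemLp (fun x => χ x * v x) 2 (volume.restrict Ω) :=
    memLp_continuous_compactSupport_smul hχ.contDiff.continuous hχ.hasCompactSupport H.memLp
  have hF : MemLp (fun x => χ x • g x + v x • gradient χ x) 2 (volume.restrict Ω) :=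
    (memLp_continuous_compactSupport_smul hχ.contDiff.continuous hχ.hasCompactSupport
      H.memLp_grad).add (memLp_smul_continuous_compactSupport (continuous_gradient hχ.contDiff_one)
        (hasCompactSupport_gradient hχ.hasCompactSupport) H.memLp)
  set f := Ω.indicator (fun x => χ x * v x) with hfdef
  set F := Ω.indicator (fun x => χ x • g x + v x • gradient χ x) with hFdef
  have hf' : MemLp f 2 volume := (memLp_indicator_iff_restrict hΩ.measurableSet).2 hf
  have hF' : MemLp F 2 volume := (memLp_indicator_iff_restrict hΩ.measurableSet).2 hF
  have hfl : LocallyIntegrable f volume := hf'.locallyIntegrable (by norm_num)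
  have hfe : f =ᵐ[volume.restrict Ω] fun x => χ x * v x := by
    filter_upwards [ae_restrict_mem hΩ.measurableSet] with x hx
    rw [hfdef, indicator_of_mem hx]
  have hFe : F =ᵐ[volume.restrict Ω] fun x => χ x • g x + v x • gradient χ x := by
    filter_upwards [ae_restrict_mem hΩ.measurableSet] with x hx
    rw [hFdef, indicator_of_mem hx]
  refine IsGradPairZero.congr ?_ hfe hFe
  let K := tsupport χ
  have hK : IsCompact K := hχ.hasCompactSupport
  have hfK : Function.support f ⊆ K := by
    intro x hx
    by_contra hxK
    refine hx ?_
    have h0 : χ x = 0 := image_eq_zero_of_notMem_tsupport hxK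
    by_cases hxΩ : x ∈ Ω <;> simp [hfdef, hxΩ, h0]
  obtain ⟨δ, hδ, hδΩ⟩ := hK.exists_cthickening_subset_open hΩ hχ.tsupport_subset
  -- Dropping the first `N` mollifiers keeps the supports of all the mollifications inside `Ω`.
  obtain ⟨N, hN⟩ := eventually_atTop.1 ((tendsto_shrinkingBump_rOut n).eventually_le_const hδ)
  let Ψ : ℕ → EuclideanSpace ℝ (Fin n) → ℝ := fun k =>
    (shrinkingBump n (k + N)).normed volume ⋆[ContinuousLinearMap.lsmul ℝ ℝ, volume] f
  have hsupp : ∀ k, Function.support (Ψ k) ⊆ Metric.cthickening δ K := by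
    intro k
    refine (support_convolution_subset _).trans ?_
    rw [ContDiffBump.support_normed_eq]
    rintro _ ⟨a, ha, b, hb, rfl⟩
    refine Metric.mem_cthickening_of_dist_le _ b δ K (hfK hb) ?_
    have ha' := (mem_ball_zero_iff.1 ha).le
    simpa using ha'.trans (hN (k + N) le_add_self)
  have hΨ : ∀ k, IsTestFunction Ω (Ψ k) := by
    intro k
    have hts : tsupport (Ψ k) ⊆ Metric.cthickening δ K :=
      closure_minimal (hsupp k) Metric.isClosed_cthickening
    refine ⟨?_, ?_, hts.trans hδΩ⟩
    · exact (ContDiffBump.hasCompactSupport_normed _).contDiff_convolution_left (n := ⊤) _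
        (ContDiffBump.contDiff_normed _) hfl
    · exact HasCompactSupport.of_support_subset_isCompact hK.cthickening (hsupp k)
  have hgrad : ∀ k, gradient (Ψ k) = (shrinkingBump n (k + N)).normed volume
      ⋆[ContinuousLinearMap.lsmul ℝ ℝ, volume] F := by
    intro k
    ext1 x
    set ρ := (shrinkingBump n (k + N)).normed
      (volume : Measure (EuclideanSpace ℝ (Fin n))) with hρ
    have hρs : ContDiff ℝ ∞ ρ := ContDiffBump.contDiff_normed _
    have hρ1 : ContDiff ℝ 1 ρ := hρs.of_le (by exact_mod_cast le_top)
    -- Testing against the reflected mollifier `ρ (x - ·)`, which need not have support in `Ω`,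
    -- moves the derivative from `ρ` to `χ v`.
    have h := H.integral_cutoff_eq hχ (η := fun y => ρ (x - y))
      (hρs.comp (contDiff_const.sub contDiff_id))
    simp only [gradient_comp_const_sub hρ1, smul_neg, integral_neg, neg_inj] at h
    rw [gradient_convolution hρ1 (ContDiffBump.hasCompactSupport_normed _) hfl,
      convolution_eq_swap]
    rw [← integral_indicator hΩ.measurableSet, ← integral_indicator hΩ.measurableSet] at h
    refine Eq.trans (integral_congr_ae (Eventually.of_forall fun y => ?_))
      (h.trans (integral_congr_ae (Eventually.of_forall fun y => ?_)))
    · by_cases hy : y ∈ Ω <;> simp [hfdef, hy]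
    · by_cases hy : y ∈ Ω <;> simp [hFdef, hy]
  refine ⟨hf'.restrict Ω, hF'.restrict Ω, Ψ, hΨ, ?_, ?_⟩
  · have ht := (tendsto_eLpNorm_normed_convolution_sub hf').comp (tendsto_add_atTop_nat N)
    exact tendsto_eLpNorm_zero_of_le ht fun k => eLpNorm_restrict_le _ _ _ _
  · have ht := (tendsto_eLpNorm_normed_convolution_sub hF').comp (tendsto_add_atTop_nat N)
    refine tendsto_eLpNorm_zero_of_le ht fun k => ?_
    rw [hgrad k]
    exact eLpNorm_restrict_le _ _ _ _

end Cutoff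

/-! ### The chain rule, absolute values and positive parts. -/

section ChainRule

theorem tendsto_eLpNorm_two_of_ae {α G : Type*} [MeasurableSpace α] [NormedAddCommGroup G]
    {μ : Measure α} {f : ℕ → α → G} (hf : ∀ k, AEStronglyMeasurable (f k) μ) {b : α → ℝ≥0∞}
    (hb : ∫⁻ x, b x ^ 2 ∂μ ≠ ⊤) (hfb : ∀ k, ∀ᵐ x ∂μ, ‖f k x‖ₑ ≤ b x)
    (hlim : ∀ᵐ x ∂μ, Tendsto (fun k => f k x) atTop (𝓝 0)) :
    Tendsto (fun k => eLpNorm (f k) 2 μ) atTop (𝓝 0) := by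
  have h := tendsto_lintegral_of_dominated_convergence' (μ := μ)
    (F := fun k x => ‖f k x‖ₑ ^ 2) (f := fun _ => 0) (fun x => b x ^ 2)
    (fun k => (hf k).enorm.pow_const 2)
    (fun k => (hfb k).mono fun x hx => pow_le_pow_left' hx 2) hb
    (hlim.mono fun x hx => by
      have := (ENNReal.continuous_pow 2).tendsto _ |>.comp hx.enorm
      simpa [Function.comp_def] using this)
  simp only [← eLpNorm_two_sq, lintegral_zero] at h
  rw [ENNReal.tendsto_atTop_zero] at h ⊢
  intro ε hε
  obtain ⟨N, hN⟩ := h (ε ^ 2) (by positivity)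
  exact ⟨N, fun k hk => (ENNReal.pow_le_pow_left_iff two_ne_zero).1 (hN k hk)⟩

theorem tendsto_eLpNorm_smul_sub_of_ae {α G : Type*} [MeasurableSpace α] [NormedAddCommGroup G]
    [NormedSpace ℝ G] {μ : Measure α} {h : ℕ → α → ℝ} {h₀ : α → ℝ} {F : α → G}
    (hm : ∀ k, AEStronglyMeasurable (h k) μ) (hm₀ : AEStronglyMeasurable h₀ μ)
    (hb : ∀ k x, |h k x| ≤ 1) (hb₀ : ∀ x, |h₀ x| ≤ 1) (hF : MemLp F 2 μ)
    (hlim : ∀ᵐ x ∂μ, Tendsto (fun k => h k x) atTop (𝓝 (h₀ x))) :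
    Tendsto (fun k => eLpNorm (fun x => h k x • F x - h₀ x • F x) 2 μ) atTop (𝓝 0) := by
  refine tendsto_eLpNorm_two_of_ae (b := fun x => 2 * ‖F x‖ₑ)
    (fun k => ((hm k).smul hF.1).sub (hm₀.smul hF.1)) ?_ (fun k => ?_) ?_
  · simp only [mul_pow]
    rw [lintegral_const_mul' _ _ (by simp), ← eLpNorm_two_sq]
    exact ENNReal.mul_ne_top (by simp) (ENNReal.pow_ne_top hF.2.ne)
  · refine Eventually.of_forall fun x => ?_
    rw [← sub_smul, enorm_smul]
    gcongr
    rw [Real.enorm_eq_ofReal_abs]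
    refine ENNReal.ofReal_le_of_le_toReal ?_
    have h1 := abs_le.1 (hb k x)
    have h2 := abs_le.1 (hb₀ x)
    simp only [ENNReal.toReal_ofNat]
    rw [abs_le]
    constructor <;> linarith
  · filter_upwards [hlim] with x hx
    have := (hx.sub_const (h₀ x)).smul_const (F x)
    simpa only [sub_self, zero_smul, sub_smul] using this

theorem memLp_smul_of_abs_le_one {α G : Type*} [MeasurableSpace α] [NormedAddCommGroup G]
    [NormedSpace ℝ G] {μ : Measure α} {h : α → ℝ} {F : α → G} (hF : MemLp F 2 μ)
    (hm : AEStronglyMeasurable h μ) (hb : ∀ x, |h x| ≤ 1) : MemLp (fun x => h x • F x) 2 μ :=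
  hF.of_le (hm.smul hF.1) (Eventually.of_forall fun x => by
    rw [norm_smul, Real.norm_eq_abs]
    exact mul_le_of_le_one_left (norm_nonneg _) (hb x))

variable {Ω : Set (EuclideanSpace ℝ (Fin n))}

/-- For test functions the chain rule is classical. In the limit `G'(ψ_k)(Dψ_k - F)` is small
because `|G'| ≤ 1`, and `(G'(ψ_k) - G'(f)) F` by dominated convergence along an a.e. convergent
subsequence. Since `G 0` may be nonzero, the result lies only in `H¹(Ω)`; boundedness of `Ω` makes
constants square integrable. -/
theorem IsGradPairZero.comp_contDiff (hΩb : Bornology.IsBounded Ω)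
    {f : EuclideanSpace ℝ (Fin n) → ℝ}
    {F : EuclideanSpace ℝ (Fin n) → EuclideanSpace ℝ (Fin n)} (H : IsGradPairZero Ω f F)
    {G : ℝ → ℝ} (hG : ContDiff ℝ 1 G) (hlip : ∀ a b, |G a - G b| ≤ |a - b|)
    (hder : ∀ a, |deriv G a| ≤ 1) :
    IsGradPair Ω (fun x => G (f x)) (fun x => deriv G (f x) • F x) := by
  have : IsFiniteMeasure (volume.restrict Ω) := ⟨by simpa using hΩb.measure_lt_top⟩
  have hG' : Continuous (deriv G) := hG.continuous_deriv le_rfl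
  have hGL : ∀ {v : EuclideanSpace ℝ (Fin n) → ℝ}, MemLp v 2 (volume.restrict Ω) →
      MemLp (fun x => G (v x)) 2 (volume.restrict Ω) := by
    intro v hv
    have h1 : MemLp (fun x => G (v x) - G 0) 2 (volume.restrict Ω) :=
      hv.of_le ((hG.continuous.comp_aestronglyMeasurable hv.1).sub aestronglyMeasurable_const)
        (Eventually.of_forall fun x => by simpa using hlip (v x) 0)
    refine (h1.add (memLp_const (G 0))).congr_norm
      (hG.continuous.comp_aestronglyMeasurable hv.1) (Eventually.of_forall fun x => ?_)
    simp
  obtain ⟨ψ, hψ, h1, h2⟩ := H.exists_seq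
  obtain ⟨σ, hσ, hae⟩ := (tendstoInMeasure_of_tendsto_eLpNorm (p := 2) two_ne_zero
    (fun k => ((hψ k).memLp 2 Ω).1) H.memLp.1 h1).exists_seq_tendsto_ae
  have hmf : AEStronglyMeasurable (fun x => deriv G (f x)) (volume.restrict Ω) :=
    hG'.comp_aestronglyMeasurable H.memLp.1
  have hmψ : ∀ k, AEStronglyMeasurable (fun x => deriv G (ψ (σ k) x)) (volume.restrict Ω) :=
    fun k => hG'.comp_aestronglyMeasurable ((hψ (σ k)).memLp 2 Ω).1
  have hpair : ∀ k, IsGradPair Ω (fun x => G (ψ (σ k) x))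
      (fun x => deriv G (ψ (σ k) x) • gradient (ψ (σ k)) x) := by
    intro k
    refine ⟨hGL ((hψ _).memLp 2 Ω), memLp_smul_of_abs_le_one ((hψ _).memLp_gradient 2 Ω) (hmψ k)
      fun x => hder _, fun η hη => ?_⟩
    have hGψ : ContDiff ℝ 1 fun x => G (ψ (σ k) x) := hG.comp (hψ _).contDiff_one
    rw [integral_smul_gradient_of_contDiff hGψ hη]
    simp only [gradient_comp_real hG (hψ _).contDiff_one]
  refine IsGradPair.of_tendsto hpair (hGL H.memLp)
    (memLp_smul_of_abs_le_one H.memLp_grad hmf fun x => hder _) ?_ ?_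
  · refine tendsto_eLpNorm_zero_of_le (h1.comp hσ.tendsto_atTop) fun k => ?_
    exact eLpNorm_mono fun x => hlip _ _
  · have t := tendsto_eLpNorm_smul_sub_of_ae hmψ hmf (fun k x => hder _) (fun x => hder _)
      H.memLp_grad (hae.mono fun x hx => (hG'.tendsto _).comp hx)
    have ht := (h2.comp hσ.tendsto_atTop).add t
    rw [add_zero] at ht
    refine tendsto_eLpNorm_zero_of_le ht fun k => ?_
    have hm1 := (hmψ k).smul ((hψ (σ k)).memLp_gradient 2 Ω).1
    have hm2 := (hmψ k).smul H.memLp_grad.1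
    refine (eLpNorm_sub_le_add hm1 hm2 (hmf.smul H.memLp_grad.1)).trans (add_le_add_left ?_ _)
    refine eLpNorm_mono fun x => ?_
    simp only [Pi.smul_apply', ← smul_sub, norm_smul, Real.norm_eq_abs]
    exact mul_le_of_le_one_left (norm_nonneg _) (hder _)

/-- A smooth approximation of the absolute value. -/
def smoothAbs (ε t : ℝ) : ℝ := √(t ^ 2 + ε ^ 2)

theorem sq_add_sq_pos {ε : ℝ} (hε : 0 < ε) (t : ℝ) : 0 < t ^ 2 + ε ^ 2 := by positivity

theorem contDiff_smoothAbs {ε : ℝ} (hε : 0 < ε) : ContDiff ℝ 1 (smoothAbs ε) :=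
  ContDiff.sqrt (by fun_prop) fun t => (sq_add_sq_pos hε t).ne'

theorem deriv_smoothAbs {ε : ℝ} (hε : 0 < ε) (t : ℝ) :
    deriv (smoothAbs ε) t = t / √(t ^ 2 + ε ^ 2) := by
  have h : HasDerivAt (fun t : ℝ => t ^ 2 + ε ^ 2) (2 * t) t := by
    simpa using (hasDerivAt_pow 2 t).add_const (ε ^ 2)
  have := (h.sqrt (sq_add_sq_pos hε t).ne').deriv
  rw [show smoothAbs ε = fun t => √(t ^ 2 + ε ^ 2) from rfl, this]
  field_simp

theorem abs_deriv_smoothAbs_le {ε : ℝ} (hε : 0 < ε) (t : ℝ) :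
    |deriv (smoothAbs ε) t| ≤ 1 := by
  rw [deriv_smoothAbs hε, abs_div, abs_of_nonneg (Real.sqrt_nonneg _)]
  refine div_le_one_of_le₀ (Real.abs_le_sqrt ?_) (Real.sqrt_nonneg _)
  nlinarith [sq_nonneg ε]

theorem abs_smoothAbs_sub_le {ε : ℝ} (hε : 0 < ε) (a b : ℝ) :
    |smoothAbs ε a - smoothAbs ε b| ≤ |a - b| := by
  have := Convex.norm_image_sub_le_of_norm_deriv_le (f := smoothAbs ε) (C := 1) (s := univ)
    (x := b) (y := a) (fun x _ => (contDiff_smoothAbs hε).differentiable one_ne_zero x)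
    (fun x _ => abs_deriv_smoothAbs_le hε x) convex_univ (mem_univ _) (mem_univ _)
  simpa using this

theorem abs_smoothAbs_sub_abs_le {ε : ℝ} (hε : 0 < ε) (t : ℝ) : |smoothAbs ε t - (|t|)| ≤ ε := by
  have h1 : |t| ≤ smoothAbs ε t := Real.abs_le_sqrt (by nlinarith [sq_nonneg ε])
  have h2 : smoothAbs ε t ≤ |t| + ε := by
    refine Real.sqrt_le_iff.2 ⟨by positivity, ?_⟩
    nlinarith [sq_abs t, abs_nonneg t]
  rw [abs_le]
  constructor <;> linarith

/-- At `t = 0` every derivative is `0`, in agreement with `Real.sign 0 = 0`. The limit therefore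
exists at every `t`, and the zero set of a function needs no separate treatment. -/
theorem tendsto_deriv_smoothAbs (t : ℝ) {ε : ℕ → ℝ} (hε : ∀ k, 0 < ε k)
    (hlim : Tendsto ε atTop (𝓝 0)) :
    Tendsto (fun k => deriv (smoothAbs (ε k)) t) atTop (𝓝 (Real.sign t)) := by
  simp only [deriv_smoothAbs (hε _)]
  rcases eq_or_ne t 0 with rfl | ht
  · simp
  · have h1 : Tendsto (fun k => √(t ^ 2 + ε k ^ 2)) atTop (𝓝 |t|) := by
      have := ((hlim.pow 2).const_add (t ^ 2)).sqrt
      simpa [Real.sqrt_sq_eq_abs] using this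
    have h2 := (tendsto_const_nhds (x := t)).div h1 (abs_ne_zero.2 ht)
    have e : t / |t| = Real.sign t := by
      rcases lt_or_gt_of_ne ht with h | h
      · rw [Real.sign_of_neg h, abs_of_neg h, div_neg, div_self ht]
      · rw [Real.sign_of_pos h, abs_of_pos h, div_self ht]
    rwa [e] at h2

theorem abs_sign_le_one (t : ℝ) : |Real.sign t| ≤ 1 := by
  rcases Real.sign_apply_eq t with h | h | h <;> simp [h]

theorem measurable_real_sign : Measurable Real.sign := by
  have e : Real.sign = fun r => if r < 0 then (-1 : ℝ) else if 0 < r then 1 else 0 := rfl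
  rw [e]
  exact Measurable.ite measurableSet_Iio measurable_const
    (Measurable.ite measurableSet_Ioi measurable_const measurable_const)

theorem IsGradPairZero.abs (hΩb : Bornology.IsBounded Ω)
    {f : EuclideanSpace ℝ (Fin n) → ℝ}
    {F : EuclideanSpace ℝ (Fin n) → EuclideanSpace ℝ (Fin n)} (H : IsGradPairZero Ω f F) :
    IsGradPair Ω (fun x => |f x|) (fun x => Real.sign (f x) • F x) := by
  have : IsFiniteMeasure (volume.restrict Ω) := ⟨by simpa using hΩb.measure_lt_top⟩
  let ε : ℕ → ℝ := fun k => 1 / ((k : ℝ) + 1)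
  have hε : ∀ k, 0 < ε k := fun k => by positivity
  have hlim : Tendsto ε atTop (𝓝 0) := tendsto_one_div_add_atTop_nhds_zero_nat
  have hpair := fun k => H.comp_contDiff hΩb (contDiff_smoothAbs (hε k))
    (abs_smoothAbs_sub_le (hε k)) (abs_deriv_smoothAbs_le (hε k))
  have hms : AEStronglyMeasurable (fun x => Real.sign (f x)) (volume.restrict Ω) :=
    (measurable_real_sign.comp_aemeasurable H.memLp.1.aemeasurable).aestronglyMeasurable
  refine IsGradPair.of_tendsto hpair H.memLp.abs
    (memLp_smul_of_abs_le_one H.memLp_grad hms fun x => abs_sign_le_one _) ?_ ?_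
  · refine tendsto_eLpNorm_two_of_ae (b := fun _ => 1)
      (fun k => ((hpair k).memLp.sub H.memLp.abs).1) (by simpa using hΩb.measure_lt_top.ne)
      (fun k => ?_) ?_
    · refine Eventually.of_forall fun x => ?_
      rw [Real.enorm_eq_ofReal_abs, ENNReal.ofReal_le_one]
      refine (abs_smoothAbs_sub_abs_le (hε k) _).trans ?_
      exact div_le_one_of_le₀ (by simp) (by positivity)
    · refine Eventually.of_forall fun x => ?_
      exact squeeze_zero_norm (fun k => abs_smoothAbs_sub_abs_le (hε k) _) hlim
  · refine tendsto_eLpNorm_smul_sub_of_ae (fun k => ?_) hms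
      (fun k x => abs_deriv_smoothAbs_le (hε k) _) (fun x => abs_sign_le_one _) H.memLp_grad
      (Eventually.of_forall fun x => tendsto_deriv_smoothAbs _ hε hlim)
    exact ((contDiff_smoothAbs (hε k)).continuous_deriv le_rfl).comp_aestronglyMeasurable H.memLp.1

/-- The weak gradient of `|v|` is `sign v • Dv`. -/
theorem IsGradPair.abs (hΩ : IsOpen Ω) (hΩb : Bornology.IsBounded Ω)
    {v : EuclideanSpace ℝ (Fin n) → ℝ}
    {g : EuclideanSpace ℝ (Fin n) → EuclideanSpace ℝ (Fin n)} (H : IsGradPair Ω v g) :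
    IsGradPair Ω (fun x => |v x|) (fun x => Real.sign (v x) • g x) := by
  have hms : AEStronglyMeasurable (fun x => Real.sign (v x)) (volume.restrict Ω) :=
    (measurable_real_sign.comp_aemeasurable H.memLp.1.aemeasurable).aestronglyMeasurable
  refine ⟨H.memLp.abs, memLp_smul_of_abs_le_one H.memLp_grad hms fun x => abs_sign_le_one _,
    fun η hη => ?_⟩
  -- Testing against `η` sees `v` only on the support of `η`. There `χ v` has the same values and
  -- gradient, and `χ v` lies in `H¹₀(Ω)`, where the formula is known.
  obtain ⟨χ, hχ, hχ1, -⟩ := exists_cutoff hη.hasCompactSupport hΩ hη.tsupport_subset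
  have h := ((H.cutoff hΩ hχ).abs hΩb).integral_eq η hη
  have e1 : ∀ x, |χ x * v x| • gradient η x = |v x| • gradient η x := by
    intro x
    by_cases hx : x ∈ tsupport η
    · rw [(hχ1 x hx).eq_of_nhds, one_mul]
    · rw [gradient_eq_zero_of_notMem_tsupport hx, smul_zero, smul_zero]
  have e2 : ∀ x, η x • (Real.sign (χ x * v x) • (χ x • g x + v x • gradient χ x)) =
      η x • (Real.sign (v x) • g x) := by
    intro x
    by_cases hx : x ∈ tsupport η
    · rw [(hχ1 x hx).gradient_eq, gradient_fun_const, (hχ1 x hx).eq_of_nhds, one_mul, one_smul,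
        smul_zero, add_zero]
    · rw [image_eq_zero_of_notMem_tsupport hx, zero_smul, zero_smul]
  simpa only [e1, e2] using h

/-- The factor `½ (1 + sign t)`, which multiplies the gradient when passing to the
positive part. -/
def posFactor (t : ℝ) : ℝ := (1 + Real.sign t) / 2

theorem posFactor_of_pos {t : ℝ} (ht : 0 < t) : posFactor t = 1 := by
  rw [posFactor, Real.sign_of_pos ht]; norm_num

/-- The value `½` occurs only at `t = 0`. What counts for minimizers is that a factor different from
`1` stays away from `1`. -/
theorem posFactor_of_nonpos {t : ℝ} (ht : t ≤ 0) : posFactor t ∈ Icc 0 (1 / 2 : ℝ) := by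
  rcases ht.lt_or_eq with h | rfl
  · rw [posFactor, Real.sign_of_neg h]; norm_num
  · rw [posFactor, Real.sign_zero]; norm_num

theorem posFactor_mem_Icc (t : ℝ) : posFactor t ∈ Icc (0 : ℝ) 1 := by
  have := abs_le.1 (abs_sign_le_one t)
  rw [posFactor]
  constructor <;> linarith [this.1, this.2]

theorem IsGradPair.posPart (hΩ : IsOpen Ω) (hΩb : Bornology.IsBounded Ω)
    {v : EuclideanSpace ℝ (Fin n) → ℝ}
    {g : EuclideanSpace ℝ (Fin n) → EuclideanSpace ℝ (Fin n)} (H : IsGradPair Ω v g) :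
    IsGradPair Ω (fun x => max (v x) 0) (fun x => posFactor (v x) • g x) := by
  have h := (H.add (H.abs hΩ hΩb)).const_mul (1 / 2)
  refine h.congr (Eventually.of_forall fun x => ?_) (Eventually.of_forall fun x => ?_)
  · simp only
    rcases le_total (v x) 0 with hx | hx
    · rw [max_eq_right hx, abs_of_nonpos hx]; ring
    · rw [max_eq_left hx, abs_of_nonneg hx]; ring
  · simp only [posFactor]
    module

end ChainRule

/-! ### Truncations of competitors are competitors. -/

section Truncation

variable {Ω : Set (EuclideanSpace ℝ (Fin n))}

theorem IsGradPairZero.exists_bounded_seq {u : EuclideanSpace ℝ (Fin n) → ℝ}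
    {g : EuclideanSpace ℝ (Fin n) → EuclideanSpace ℝ (Fin n)} (H : IsGradPairZero Ω u g) :
    ∃ ψ : ℕ → EuclideanSpace ℝ (Fin n) → ℝ, (∀ k, IsTestFunction Ω (ψ k)) ∧
      Tendsto (fun k => eLpNorm (fun x => ψ k x - u x) 2 (volume.restrict Ω)) atTop (𝓝 0) ∧
      (∀ k, eLpNorm (fun x => ψ k x - u x) 2 (volume.restrict Ω) ≤ 1) ∧
      ∀ k, eLpNorm (fun x => gradient (ψ k) x - g x) 2 (volume.restrict Ω) ≤ 1 := by
  obtain ⟨ψ, hψ, h1, h2⟩ := H.exists_seq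
  obtain ⟨N, hN⟩ := eventually_atTop.1
    ((h1.eventually_le_const one_pos).and (h2.eventually_le_const one_pos))
  exact ⟨fun k => ψ (k + N), fun k => hψ _, h1.comp (tendsto_add_atTop_nat N),
    fun k => (hN _ le_add_self).1, fun k => (hN _ le_add_self).2⟩

theorem abs_max_zero_sub_le (a b : ℝ) : |max a 0 - max b 0| ≤ |a - b| :=
  abs_max_sub_max_le_abs a b 0

/-- Truncating from below at a nonnegative obstacle preserves membership in `H¹₀(Ω)`. -/
theorem IsGradPairZero.exists_posPart_add_sub (hΩ : IsOpen Ω) (hΩb : Bornology.IsBounded Ω)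
    {w f : EuclideanSpace ℝ (Fin n) → ℝ}
    {G F : EuclideanSpace ℝ (Fin n) → EuclideanSpace ℝ (Fin n)} (H : IsGradPairZero Ω w G)
    (Hf : IsGradPair Ω f F) (hf : ∀ᵐ x ∂volume.restrict Ω, 0 ≤ f x) :
    ∃ g, IsGradPairZero Ω (fun x => max (w x + f x) 0 - f x) g := by
  obtain ⟨ψ, hψ, h1, h1', h2'⟩ := H.exists_bounded_seq
  choose χ hχ hχ1 hχI using fun k =>
    exists_cutoff (hψ k).hasCompactSupport hΩ (hψ k).tsupport_subset
  -- Where `ψ k = 0` the truncation changes nothing, as `f ≥ 0`. So `(ψ k + f)⁺ - f` lives on the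
  -- support of `ψ k`, and a cutoff puts it in `H¹₀(Ω)`. As `posFactor` is discontinuous, the
  -- gradients are only shown to be bounded, and weak compactness supplies the limit.
  let θ : ℕ → EuclideanSpace ℝ (Fin n) → ℝ := fun k x => posFactor (ψ k x + f x)
  have hm : ∀ k, IsGradPair Ω (fun x => max (ψ k x + f x) 0 - f x)
      (fun x => θ k x • (gradient (ψ k) x + F x) - F x) := fun k =>
    (((hψ k).isGradPair.add Hf).posPart hΩ hΩb).sub Hf
  have hzero : ∀ k x, 0 ≤ f x → x ∉ tsupport (ψ k) → max (ψ k x + f x) 0 - f x = 0 := by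
    intro k x hx hxs
    rw [image_eq_zero_of_notMem_tsupport hxs, zero_add, max_eq_left hx, sub_self]
  have hpair : ∀ k, IsGradPairZero Ω (fun x => max (ψ k x + f x) 0 - f x)
      (fun x => χ k x • (θ k x • (gradient (ψ k) x + F x) - F x)) := by
    intro k
    refine ((hm k).cutoff hΩ (hχ k)).congr ?_ ?_
    · filter_upwards [hf] with x hx
      by_cases hxs : x ∈ tsupport (ψ k)
      · rw [(hχ1 k x hxs).eq_of_nhds, one_mul]
      · rw [hzero k x hx hxs, mul_zero]
    · filter_upwards [hf] with x hx
      by_cases hxs : x ∈ tsupport (ψ k)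
      · rw [(hχ1 k x hxs).gradient_eq, gradient_fun_const, smul_zero, add_zero]
      · rw [hzero k x hx hxs, zero_smul, add_zero]
  have hbu : ∀ k, eLpNorm (fun x => max (ψ k x + f x) 0 - f x) 2 (volume.restrict Ω) ≤
      eLpNorm w 2 (volume.restrict Ω) + 1 := by
    intro k
    refine (eLpNorm_mono_ae (g := ψ k) ?_).trans
      ((eLpNorm_le_add_eLpNorm_sub ((hψ k).memLp 2 Ω).1 H.memLp.1).trans
        (add_le_add_right (h1' k) _))
    filter_upwards [hf] with x hx
    have := abs_max_zero_sub_le (ψ k x + f x) (f x)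
    rw [max_eq_left hx, add_sub_cancel_right] at this
    exact this
  have hbg : ∀ k, eLpNorm (fun x => χ k x • (θ k x • (gradient (ψ k) x + F x) - F x)) 2
      (volume.restrict Ω) ≤ eLpNorm G 2 (volume.restrict Ω) + 1
        + eLpNorm F 2 (volume.restrict Ω) := by
    intro k
    have hg := (hψ k).memLp_gradient 2 Ω
    calc eLpNorm (fun x => χ k x • (θ k x • (gradient (ψ k) x + F x) - F x)) 2
          (volume.restrict Ω)
        ≤ eLpNorm ((fun x => ‖gradient (ψ k) x‖) + fun x => ‖F x‖) 2 (volume.restrict Ω) := by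
          refine eLpNorm_mono_real fun x => ?_
          have hθ := posFactor_mem_Icc (ψ k x + f x)
          have hχx := hχI k x
          have e : θ k x • (gradient (ψ k) x + F x) - F x =
              θ k x • gradient (ψ k) x - (1 - θ k x) • F x := by module
          rw [norm_smul, Real.norm_of_nonneg hχx.1, e]
          refine (mul_le_of_le_one_left (norm_nonneg _) hχx.2).trans
            ((norm_sub_le _ _).trans (add_le_add ?_ ?_))
          · rw [norm_smul, Real.norm_of_nonneg hθ.1]
            exact mul_le_of_le_one_left (norm_nonneg _) hθ.2
          · rw [norm_smul, Real.norm_of_nonneg (sub_nonneg.2 hθ.2)]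
            exact mul_le_of_le_one_left (norm_nonneg _) (sub_le_self _ hθ.1)
      _ ≤ eLpNorm (gradient (ψ k)) 2 (volume.restrict Ω) + eLpNorm F 2 (volume.restrict Ω) := by
          refine (eLpNorm_add_le hg.1.norm Hf.memLp_grad.1.norm (by norm_num)).trans ?_
          rw [eLpNorm_norm, eLpNorm_norm]
      _ ≤ _ := by
          gcongr
          exact (eLpNorm_le_add_eLpNorm_sub hg.1 H.memLp_grad.1).trans
            (add_le_add_right (h2' k) _)
  let C : ℝ≥0∞ := (eLpNorm w 2 (volume.restrict Ω) + 1) +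
    (eLpNorm G 2 (volume.restrict Ω) + 1 + eLpNorm F 2 (volume.restrict Ω))
  have hC : C ≠ ⊤ := by
    simp [C, H.memLp.2.ne, H.memLp_grad.2.ne, Hf.memLp_grad.2.ne]
  refine IsGradPairZero.exists_of_tendsto hpair hC (fun k => (hbu k).trans le_self_add)
    (fun k => (hbg k).trans le_add_self)
    (((H.isGradPair.add Hf).posPart hΩ hΩb).sub Hf).memLp ?_
  refine tendsto_eLpNorm_zero_of_le h1 fun k => eLpNorm_mono fun x => ?_
  have := abs_max_zero_sub_le (ψ k x + f x) (w x + f x)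
  simpa using this

theorem mem_admissible_iff (hΩ : IsOpen Ω) (hΩb : Bornology.IsBounded Ω)
    {φ v : EuclideanSpace ℝ (Fin n) → ℝ} (hφ : MemH1 Ω φ) :
    v ∈ admissible Ω φ ↔ ∃ g, IsGradPairZero Ω (fun x => v x - φ x) g := by
  constructor
  · rintro ⟨-, h⟩
    exact ⟨_, h.isGradPairZero hΩ⟩
  · rintro ⟨g, h⟩
    refine ⟨?_, h.memH10 hΩ hΩb⟩
    have h' := h.isGradPair.add (hφ.isGradPair hΩ)
    simp only [sub_add_cancel] at h'
    exact h'.memH1 hΩb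

theorem posPart_mem_admissible (hΩ : IsOpen Ω) (hΩb : Bornology.IsBounded Ω)
    {φ u : EuclideanSpace ℝ (Fin n) → ℝ} (hφ : MemH1 Ω φ)
    (hφ0 : ∀ᵐ x ∂volume.restrict Ω, 0 ≤ φ x) (hu : u ∈ admissible Ω φ) :
    (fun x => max (u x) 0) ∈ admissible Ω φ := by
  obtain ⟨G, hG⟩ := (mem_admissible_iff hΩ hΩb hφ).1 hu
  obtain ⟨g, hg⟩ := hG.exists_posPart_add_sub hΩ hΩb (hφ.isGradPair hΩ) hφ0
  simp only [sub_add_cancel] at hg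
  exact (mem_admissible_iff hΩ hΩb hφ).2 ⟨g, hg⟩

/-- Truncation from below, applied to `w = φ - u` with obstacle function `f = M - φ ≥ 0`: `(M - u)⁺
- (M - φ) = φ - min u M`. -/
theorem min_const_mem_admissible (hΩ : IsOpen Ω) (hΩb : Bornology.IsBounded Ω)
    {φ u : EuclideanSpace ℝ (Fin n) → ℝ} (hφ : MemH1 Ω φ) {M : ℝ}
    (hφM : ∀ᵐ x ∂volume.restrict Ω, φ x ≤ M) (hu : u ∈ admissible Ω φ) :
    (fun x => min (u x) M) ∈ admissible Ω φ := by
  obtain ⟨G, hG⟩ := (mem_admissible_iff hΩ hΩb hφ).1 hu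
  obtain ⟨g, hg⟩ := hG.neg.exists_posPart_add_sub hΩ hΩb
    ((IsGradPair.const hΩb M).sub (hφ.isGradPair hΩ)) (hφM.mono fun x hx => sub_nonneg.2 hx)
  refine (mem_admissible_iff hΩ hΩb hφ).2 ⟨_, hg.neg.congr
    (Eventually.of_forall fun x => ?_) EventuallyEq.rfl⟩
  simp only
  rcases le_total (u x) M with h | h
  · rw [min_eq_left h, max_eq_left (by linarith)]; ring
  · rw [min_eq_right h, max_eq_right (by linarith)]; ring

end Truncation

/-! ### The energy and its potential part. -/

section Energy

variable {Ω : Set (EuclideanSpace ℝ (Fin n))} {δ γ : EuclideanSpace ℝ (Fin n) → ℝ}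

/-- The zeroth order part of the energy. -/
def potentialEnergy (Ω : Set (EuclideanSpace ℝ (Fin n))) (δ γ v : EuclideanSpace ℝ (Fin n) → ℝ) :
    ℝ≥0∞ := ∫⁻ x in Ω, ENNReal.ofReal (δ x * max (v x) 0 ^ γ x)

theorem aemeasurable_potential (hδ : AEMeasurable δ (volume.restrict Ω))
    (hγ : AEMeasurable γ (volume.restrict Ω)) {v : EuclideanSpace ℝ (Fin n) → ℝ}
    (hv : AEMeasurable v (volume.restrict Ω)) :
    AEMeasurable (fun x => ENNReal.ofReal (δ x * max (v x) 0 ^ γ x)) (volume.restrict Ω) :=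
  (hδ.mul ((hv.max aemeasurable_const).pow hγ)).ennreal_ofReal

theorem ofReal_half_norm_sq {G : Type*} [NormedAddCommGroup G] (a : G) :
    ENNReal.ofReal (1 / 2 * ‖a‖ ^ 2) = ENNReal.ofReal (1 / 2) * ‖a‖ₑ ^ 2 := by
  rw [ENNReal.ofReal_mul (by norm_num), ENNReal.ofReal_pow (norm_nonneg _), ofReal_norm]

/-- Any a.e. version of the gradient computes the energy, so the chosen `weakGradient` can be left
behind. -/
theorem energy_eq (hΩ : IsOpen Ω) (hΩb : Bornology.IsBounded Ω) (hδ : ∀ x ∈ Ω, 0 ≤ δ x)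
    {v : EuclideanSpace ℝ (Fin n) → ℝ}
    {g : EuclideanSpace ℝ (Fin n) → EuclideanSpace ℝ (Fin n)} (H : IsGradPair Ω v g) :
    energy Ω δ γ v = ENNReal.ofReal (1 / 2) * eLpNorm g 2 (volume.restrict Ω) ^ 2
      + potentialEnergy Ω δ γ v := by
  rw [eLpNorm_two_sq, ← lintegral_const_mul' _ _ (by simp), potentialEnergy,
    ← lintegral_add_left' ((H.memLp_grad.1.enorm.pow_const 2).const_mul _), energy]
  refine lintegral_congr_ae ?_
  filter_upwards [H.weakGradient_ae_eq hΩ hΩb, ae_restrict_mem hΩ.measurableSet] with x hx hxΩ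
  rw [hx, ENNReal.ofReal_add (by positivity)
    (mul_nonneg (hδ x hxΩ) (Real.rpow_nonneg (le_max_right _ _) _)), ofReal_half_norm_sq]

/-- For `0 ≤ γ ≤ 1` one has `t^γ ≤ 1 + t`, which is integrable on a bounded set. Finiteness is what
allows potential terms to be cancelled in `[0, ∞]`. -/
theorem potentialEnergy_ne_top (hΩ : IsOpen Ω) (hΩb : Bornology.IsBounded Ω)
    (hδ : ∀ x ∈ Ω, 0 ≤ δ x) {C : ℝ} (hδC : ∀ x ∈ Ω, δ x ≤ C) (hγ : ∀ x ∈ Ω, 0 ≤ γ x)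
    (hγ1 : ∀ᵐ x ∂volume.restrict Ω, γ x ≤ 1) {v : EuclideanSpace ℝ (Fin n) → ℝ}
    (hv : MemLp v 2 (volume.restrict Ω)) : potentialEnergy Ω δ γ v ≠ ⊤ := by
  have : IsFiniteMeasure (volume.restrict Ω) := ⟨by simpa using hΩb.measure_lt_top⟩
  have hi : Integrable (fun x => C * (1 + ‖v x‖)) (volume.restrict Ω) :=
    ((integrable_const 1).add (hv.integrable (by norm_num)).norm).const_mul C
  refine ne_top_of_le_ne_top hi.lintegral_lt_top.ne (lintegral_mono_ae ?_)
  filter_upwards [hγ1, ae_restrict_mem hΩ.measurableSet] with x hx hxΩ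
  refine ENNReal.ofReal_le_ofReal ?_
  have hpow : max (v x) 0 ^ γ x ≤ 1 + ‖v x‖ := by
    have h0 : 0 ≤ max (v x) 0 := le_max_right _ _
    have h1 : max (v x) 0 ≤ ‖v x‖ := max_le (le_abs_self _) (norm_nonneg _)
    rcases le_total (max (v x) 0) 1 with h | h
    · exact (Real.rpow_le_one h0 h (hγ x hxΩ)).trans (le_add_of_nonneg_right (norm_nonneg _))
    · exact (Real.rpow_le_rpow_of_exponent_le h hx).trans (by rw [Real.rpow_one]; linarith)
  exact mul_le_mul (hδC x hxΩ) hpow (Real.rpow_nonneg (le_max_right _ _) _)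
    ((hδ x hxΩ).trans (hδC x hxΩ))

theorem potentialEnergy_mono (hΩ : IsOpen Ω) (hδ : ∀ x ∈ Ω, 0 ≤ δ x) (hγ : ∀ x ∈ Ω, 0 ≤ γ x)
    {u v : EuclideanSpace ℝ (Fin n) → ℝ} (h : ∀ x, max (v x) 0 ≤ max (u x) 0) :
    potentialEnergy Ω δ γ v ≤ potentialEnergy Ω δ γ u := by
  refine lintegral_mono_ae ?_
  filter_upwards [ae_restrict_mem hΩ.measurableSet] with x hxΩ
  exact ENNReal.ofReal_le_ofReal (mul_le_mul_of_nonneg_left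
    (Real.rpow_le_rpow (le_max_right _ _) (h x) (hγ x hxΩ)) (hδ x hxΩ))

/-- Fatou's lemma, with the continuity of `t ↦ t^γ` on `[0, ∞)`. -/
theorem potentialEnergy_le_liminf (hΩ : IsOpen Ω) (hδm : AEMeasurable δ (volume.restrict Ω))
    (hγm : AEMeasurable γ (volume.restrict Ω)) (hγ : ∀ x ∈ Ω, 0 ≤ γ x)
    {u : EuclideanSpace ℝ (Fin n) → ℝ} {v : ℕ → EuclideanSpace ℝ (Fin n) → ℝ}
    (hv : ∀ k, AEMeasurable (v k) (volume.restrict Ω))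
    (hlim : ∀ᵐ x ∂volume.restrict Ω, Tendsto (fun k => v k x) atTop (𝓝 (u x))) :
    potentialEnergy Ω δ γ u ≤ liminf (fun k => potentialEnergy Ω δ γ (v k)) atTop := by
  refine le_trans (lintegral_mono_ae ?_)
    (lintegral_liminf_le' fun k => aemeasurable_potential hδm hγm (hv k))
  filter_upwards [hlim, ae_restrict_mem hΩ.measurableSet] with x hx hxΩ
  have h1 : Tendsto (fun k => max (v k x) 0) atTop (𝓝 (max (u x) 0)) :=
    hx.max tendsto_const_nhds
  have h2 := ENNReal.tendsto_ofReal ((h1.rpow_const (p := γ x) (Or.inr (hγ x hxΩ))).const_mul (δ x))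
  exact h2.liminf_eq.ge

end Energy

/-! ### Bounds for minimizers and their existence. -/

section Minimizers

variable {Ω : Set (EuclideanSpace ℝ (Fin n))} {δ γ φ : EuclideanSpace ℝ (Fin n) → ℝ}

theorem mem_admissible_self (hΩ : IsOpen Ω) (hΩb : Bornology.IsBounded Ω) (hφ : MemH1 Ω φ) :
    φ ∈ admissible Ω φ := by
  refine (mem_admissible_iff hΩ hΩb hφ).2
    ⟨gradient fun _ : EuclideanSpace ℝ (Fin n) => (0 : ℝ), ?_⟩
  simp only [sub_self]
  exact IsTestFunction.zero.isGradPairZero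

/-- If multiplying the gradient of a minimizer by a factor with values in `[0, ½] ∪ {1}` yields
the gradient of a competitor whose potential energy is no larger, then this competitor coincides
with the minimizer. -/
theorem IsMinimizer.ae_eq_of_gradient_factor (hn : 1 ≤ n) (hΩ : IsOpen Ω)
    (hΩb : Bornology.IsBounded Ω) (hδ : ∀ x ∈ Ω, 0 ≤ δ x) (hφ : MemH1 Ω φ)
    {u v θ : EuclideanSpace ℝ (Fin n) → ℝ} (hu : IsMinimizer Ω δ γ φ u)
    (hfin : potentialEnergy Ω δ γ u ≠ ⊤) (hv : v ∈ admissible Ω φ)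
    (hvθ : IsGradPair Ω v fun x => θ x • weakGradient Ω u x)
    (hθ : ∀ x, θ x = 1 ∨ θ x ∈ Icc 0 (1 / 2 : ℝ))
    (hpot : potentialEnergy Ω δ γ v ≤ potentialEnergy Ω δ γ u) :
    v =ᵐ[volume.restrict Ω] u := by
  have Hu := hu.1.1.isGradPair hΩ
  have hmin := hu.2 v hv
  rw [energy_eq hΩ hΩb hδ Hu, energy_eq hΩ hΩb hδ hvθ] at hmin
  have hle : eLpNorm (weakGradient Ω u) 2 (volume.restrict Ω) ^ 2 ≤
      eLpNorm (fun x => θ x • weakGradient Ω u x) 2 (volume.restrict Ω) ^ 2 := by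
    have h1 := (ENNReal.add_le_add_iff_right hfin).1 (hmin.trans (add_le_add_right hpot _))
    exact (ENNReal.mul_le_mul_iff_right (by simp) (by simp)).1 h1
  rw [eLpNorm_two_sq, eLpNorm_two_sq] at hle
  have hθle : ∀ x, ‖θ x • weakGradient Ω u x‖ₑ ^ 2 ≤ ‖weakGradient Ω u x‖ₑ ^ 2 := by
    intro x
    refine pow_le_pow_left' (enorm_le_iff_norm_le.2 ?_) 2
    rw [norm_smul]
    refine mul_le_of_le_one_left (norm_nonneg _) ?_
    rcases hθ x with h | h
    · simp [h]
    · rw [Real.norm_of_nonneg h.1]; linarith [h.2]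
  -- `|θ Du| ≤ |Du|` holds pointwise, while minimality gives the reverse inequality of integrals; so
  -- equality holds a.e.
  have hae := ae_eq_of_ae_le_of_lintegral_le (Eventually.of_forall hθle)
    (by
      rw [← eLpNorm_two_sq]
      exact ENNReal.pow_ne_top hvθ.memLp_grad.2.ne)
    (Hu.memLp_grad.1.enorm.pow_const 2) hle
  have hzero : (fun x => θ x • weakGradient Ω u x - weakGradient Ω u x)
      =ᵐ[volume.restrict Ω] fun _ => 0 := by
    filter_upwards [hae] with x hx
    rcases hθ x with h | h
    · rw [h, one_smul, sub_self]
    · have hx' : ‖θ x • weakGradient Ω u x‖ = ‖weakGradient Ω u x‖ := by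
        have := (ENNReal.pow_right_strictMono two_ne_zero).injective hx
        have h' := congrArg ENNReal.toReal this
        rwa [toReal_enorm, toReal_enorm] at h'
      rw [norm_smul, Real.norm_of_nonneg h.1] at hx'
      have h0 : ‖weakGradient Ω u x‖ = 0 := by nlinarith [norm_nonneg (weakGradient Ω u x), h.2]
      rw [norm_eq_zero.1 h0, smul_zero, sub_zero]
  obtain ⟨g1, h1⟩ := (mem_admissible_iff hΩ hΩb hφ).1 hv
  obtain ⟨g2, h2⟩ := (mem_admissible_iff hΩ hΩb hφ).1 hu.1
  -- `v - u` lies in `H¹₀(Ω)` because both have boundary values `φ`; its gradient is zero, so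
  -- Poincaré finishes.
  have hd := h1.sub h2
  simp only [sub_sub_sub_cancel_right] at hd
  have hg : (fun x => g1 x - g2 x) =ᵐ[volume.restrict Ω] fun _ => 0 :=
    ((hd.isGradPair.weakGradient_ae_eq hΩ hΩb).symm.trans
      ((hvθ.sub Hu).weakGradient_ae_eq hΩ hΩb)).trans hzero
  obtain ⟨C, hC, hP⟩ := exists_poincare_const hn hΩ.measurableSet hΩb
  have hn0 : eLpNorm (fun x => v x - u x) 2 (volume.restrict Ω) = 0 := by
    have := hP _ _ hd
    rw [eLpNorm_congr_ae hg] at this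
    simpa using this
  rw [eLpNorm_eq_zero_iff hd.memLp.1 two_ne_zero] at hn0
  filter_upwards [hn0] with x hx
  exact sub_eq_zero.1 hx

/-- The minimizer coincides with its truncations `u⁺` and `min u M`, where `M = ‖φ‖_∞`.
Nonnegativity turns the one-sided bound `u ≤ M` into a bound on `|u|`. -/
theorem IsMinimizer.nonneg_and_eLpNorm_le (hn : 1 ≤ n) (hΩ : IsOpen Ω)
    (hΩb : Bornology.IsBounded Ω) (hδ : ∀ x ∈ Ω, 0 ≤ δ x) (hγ : ∀ x ∈ Ω, 0 ≤ γ x)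
    (hφ : MemH1 Ω φ) (hφL : MemLp φ ∞ (volume.restrict Ω))
    (hφ0 : ∀ᵐ x ∂volume.restrict Ω, 0 ≤ φ x) {u : EuclideanSpace ℝ (Fin n) → ℝ}
    (hu : IsMinimizer Ω δ γ φ u) (hfin : potentialEnergy Ω δ γ u ≠ ⊤) :
    (∀ᵐ x ∂volume.restrict Ω, 0 ≤ u x) ∧
      eLpNorm u ∞ (volume.restrict Ω) ≤ eLpNorm φ ∞ (volume.restrict Ω) := by
  have Hu := hu.1.1.isGradPair hΩ
  have hfac : ∀ t, posFactor t = 1 ∨ posFactor t ∈ Icc 0 (1 / 2 : ℝ) := fun t =>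
    (lt_or_ge 0 t).imp posFactor_of_pos posFactor_of_nonpos
  have hpos : ∀ᵐ x ∂volume.restrict Ω, 0 ≤ u x := by
    have h := hu.ae_eq_of_gradient_factor hn hΩ hΩb hδ hφ hfin
      (posPart_mem_admissible hΩ hΩb hφ hφ0 hu.1) (Hu.posPart hΩ hΩb) (fun x => hfac _)
      (potentialEnergy_mono hΩ hδ hγ fun x => by simp)
    filter_upwards [h] with x hx
    rw [← hx]
    exact le_max_right _ _
  refine ⟨hpos, ?_⟩
  let M := (eLpNorm φ ∞ (volume.restrict Ω)).toReal
  have hφM : ∀ᵐ x ∂volume.restrict Ω, φ x ≤ M := by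
    filter_upwards [ae_le_eLpNormEssSup (f := φ) (μ := volume.restrict Ω)] with x hx
    rw [← eLpNorm_exponent_top] at hx
    have h1 := ENNReal.toReal_mono hφL.2.ne hx
    rw [toReal_enorm] at h1
    exact (le_abs_self _).trans h1
  have hpair : IsGradPair Ω (fun x => min (u x) M)
      (fun x => posFactor (M - u x) • weakGradient Ω u x) := by
    -- `min u M = M - (M - u)⁺`.
    have h := (IsGradPair.const hΩb M).sub
      (((IsGradPair.const hΩb M).sub Hu).posPart hΩ hΩb)
    refine h.congr (Eventually.of_forall fun x => ?_) (Eventually.of_forall fun x => ?_)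
    · simp only
      rcases le_total (u x) M with h | h
      · rw [min_eq_left h, max_eq_left (by linarith)]; ring
      · rw [min_eq_right h, max_eq_right (by linarith)]; ring
    · simp only
      module
  have h := hu.ae_eq_of_gradient_factor hn hΩ hΩb hδ hφ hfin
    (min_const_mem_admissible hΩ hΩb hφ hφM hu.1) hpair (fun x => hfac _)
    (potentialEnergy_mono hΩ hδ hγ fun x => max_le_max_right 0 (min_le_left _ _))
  have huM : ∀ᵐ x ∂volume.restrict Ω, ‖u x‖ ≤ M := by
    filter_upwards [h, hpos] with x hx hx0
    rw [Real.norm_of_nonneg hx0, ← hx]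
    exact min_le_right _ _
  refine (eLpNorm_le_of_ae_bound huM).trans (le_of_eq ?_)
  rw [ENNReal.ofReal_toReal hφL.2.ne]
  simp

/-- The crude bound `t ≤ 1 + t²` avoids square roots in `[0, ∞]`; any finite bound depending only on
`B` would do. -/
theorem eLpNorm_two_le_of_half_sq_le {α G : Type*} [MeasurableSpace α] [NormedAddCommGroup G]
    {μ : Measure α} {g : α → G} {B : ℝ≥0∞}
    (h : ENNReal.ofReal (1 / 2) * eLpNorm g 2 μ ^ 2 ≤ B) : eLpNorm g 2 μ ≤ 1 + 2 * B := by
  rcases le_total (eLpNorm g 2 μ) 1 with h1 | h1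
  · exact h1.trans le_self_add
  · have e : (2 : ℝ≥0∞) * ENNReal.ofReal (1 / 2) = 1 := by
      rw [← ENNReal.ofReal_ofNat, ← ENNReal.ofReal_mul (by norm_num)]; norm_num
    calc eLpNorm g 2 μ ≤ eLpNorm g 2 μ ^ 2 := le_self_pow₀ h1 two_ne_zero
      _ = 2 * (ENNReal.ofReal (1 / 2) * eLpNorm g 2 μ ^ 2) := by rw [← mul_assoc, e, one_mul]
      _ ≤ 2 * B := by gcongr
      _ ≤ 1 + 2 * B := le_add_self

theorem integrable_inner_of_memLp_two {α : Type*} [MeasurableSpace α] {μ : Measure α}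
    {f g : α → EuclideanSpace ℝ (Fin n)} (hf : MemLp f 2 μ) (hg : MemLp g 2 μ) :
    Integrable (fun x => inner ℝ (f x) (g x)) μ := by
  refine (L2.integrable_inner (𝕜 := ℝ) (hf.toLp f) (hg.toLp g)).congr ?_
  filter_upwards [hf.coeFn_toLp, hg.coeFn_toLp] with x h1 h2
  rw [h1, h2]

theorem ofReal_integral_norm_sq {α : Type*} [MeasurableSpace α] {μ : Measure α}
    {g : α → EuclideanSpace ℝ (Fin n)} (hg : MemLp g 2 μ) :
    ENNReal.ofReal (∫ x, inner ℝ (g x) (g x) ∂μ) = eLpNorm g 2 μ ^ 2 := by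
  rw [ofReal_integral_eq_lintegral_ofReal (integrable_inner_of_memLp_two hg hg)
    (Eventually.of_forall fun x => real_inner_self_nonneg), eLpNorm_two_sq]
  refine lintegral_congr fun x => ?_
  rw [real_inner_self_eq_norm_sq, ENNReal.ofReal_pow (norm_nonneg _), ofReal_norm]

/-- The Dirichlet energy lies above its tangent planes. -/
theorem ofReal_inner_sub_le_half_sq {α : Type*} [MeasurableSpace α] {μ : Measure α}
    {f g : α → EuclideanSpace ℝ (Fin n)} (hf : MemLp f 2 μ) (hg : MemLp g 2 μ) :
    ENNReal.ofReal (∫ x, inner ℝ (f x) (g x) ∂μ - 1 / 2 * ∫ x, inner ℝ (g x) (g x) ∂μ) ≤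
      ENNReal.ofReal (1 / 2) * eLpNorm f 2 μ ^ 2 := by
  rw [← ofReal_integral_norm_sq hf, ← ENNReal.ofReal_mul (by norm_num)]
  refine ENNReal.ofReal_le_ofReal ?_
  have i1 := integrable_inner_of_memLp_two hf hg
  have i2 := (integrable_inner_of_memLp_two hg hg).const_mul (1 / 2)
  have i3 := (integrable_inner_of_memLp_two hf hf).const_mul (1 / 2)
  rw [← integral_const_mul, ← integral_const_mul, ← integral_sub i1 i2]
  refine integral_mono (i1.sub i2) i3 fun x => ?_
  -- Expanding `|f - g|² ≥ 0` gives `⟨f, g⟩ - ½|g|² ≤ ½|f|²`.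
  have h := real_inner_self_nonneg (x := f x - g x)
  rw [inner_sub_left, inner_sub_right, inner_sub_right, real_inner_comm (f x) (g x)] at h
  simp only
  linarith

theorem exists_isMinimizer (hn : 1 ≤ n) (hΩ : IsOpen Ω) (hΩb : Bornology.IsBounded Ω)
    (hδm : AEMeasurable δ (volume.restrict Ω)) (hδ : ∀ x ∈ Ω, 0 ≤ δ x)
    (hγm : AEMeasurable γ (volume.restrict Ω)) (hγ : ∀ x ∈ Ω, 0 ≤ γ x)
    (hφ : MemH1 Ω φ) (hfin : potentialEnergy Ω δ γ φ ≠ ⊤) :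
    ∃ u, IsMinimizer Ω δ γ φ u := by
  have Hφ := hφ.isGradPair hΩ
  set m := sInf (energy Ω δ γ '' admissible Ω φ) with hm
  have hφadm := mem_admissible_self hΩ hΩb hφ
  have hmtop : m ≠ ⊤ := by
    refine ne_top_of_le_ne_top ?_ (sInf_le (mem_image_of_mem _ hφadm))
    rw [energy_eq hΩ hΩb hδ Hφ]
    exact ENNReal.add_ne_top.2 ⟨ENNReal.mul_ne_top (by simp)
      (ENNReal.pow_ne_top Hφ.memLp_grad.2.ne), hfin⟩
  have hlim1 : Tendsto (fun k : ℕ => ((k : ℝ≥0∞) + 1)⁻¹) atTop (𝓝 0) := by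
    have := (tendsto_add_atTop_iff_nat 1).2 ENNReal.tendsto_inv_nat_nhds_zero
    simpa using this
  have hseq : ∀ k : ℕ, ∃ v ∈ admissible Ω φ, energy Ω δ γ v ≤ m + ((k : ℝ≥0∞) + 1)⁻¹ := by
    intro k
    have hlt : m < m + ((k : ℝ≥0∞) + 1)⁻¹ :=
      ENNReal.lt_add_right hmtop (by simp [ENNReal.add_eq_top])
    obtain ⟨_, ⟨v, hv, rfl⟩, hvlt⟩ := sInf_lt_iff.1 hlt
    exact ⟨v, hv, hvlt.le⟩
  choose v hv hvm using hseq
  have Hv := fun k => (hv k).1.isGradPair hΩ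
  set g : ℕ → EuclideanSpace ℝ (Fin n) → EuclideanSpace ℝ (Fin n) :=
    fun k => weakGradient Ω (v k) with hg
  have hve := fun k => energy_eq (γ := γ) hΩ hΩb hδ (Hv k)
  have hpair : ∀ k, IsGradPairZero Ω (fun x => v k x - φ x)
      (fun x => g k x - weakGradient Ω φ x) := by
    intro k
    obtain ⟨G, hG⟩ := (mem_admissible_iff hΩ hΩb hφ).1 (hv k)
    -- By a.e. uniqueness, the gradient `G` coming from `H¹₀(Ω)` is the difference of the two chosen
    -- gradients.
    exact hG.congr EventuallyEq.rfl ((hG.isGradPair.weakGradient_ae_eq hΩ hΩb).symm.trans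
      (((Hv k).sub Hφ).weakGradient_ae_eq hΩ hΩb))
  obtain ⟨P, hP, hPoin⟩ := exists_poincare_const hn hΩ.measurableSet hΩb
  -- Every `v k` has energy at most `m + 1`, so its gradient has norm at most `1 + 2(m + 1)`; the
  -- last term accounts for subtracting `φ`.
  let B : ℝ≥0∞ := 1 + 2 * (m + 1) + eLpNorm (weakGradient Ω φ) 2 (volume.restrict Ω)
  have hB : B ≠ ⊤ := by
    simp [B, ENNReal.add_eq_top, ENNReal.mul_eq_top, hmtop, Hφ.memLp_grad.2.ne]
  have hgB : ∀ k, eLpNorm (fun x => g k x - weakGradient Ω φ x) 2 (volume.restrict Ω) ≤ B := by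
    intro k
    refine (eLpNorm_sub_le (Hv k).memLp_grad.1 Hφ.memLp_grad.1 (by norm_num)).trans ?_
    refine add_le_add_left (eLpNorm_two_le_of_half_sq_le ?_) _
    calc _ ≤ energy Ω δ γ (v k) := by rw [hve k]; exact le_self_add
      _ ≤ m + ((k : ℝ≥0∞) + 1)⁻¹ := hvm k
      _ ≤ m + 1 := by
        gcongr
        rw [ENNReal.inv_le_one]
        exact le_add_self
  have hC : B + P * B ≠ ⊤ := ENNReal.add_ne_top.2 ⟨hB, ENNReal.mul_ne_top hP hB⟩
  have hUC : ∀ k, eLpNorm (fun x => v k x - φ x) 2 (volume.restrict Ω) ≤ B + P * B := fun k =>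
    ((hPoin _ _ (hpair k)).trans (mul_le_mul_right (hgB k) _)).trans le_add_self
  have hGC : ∀ k, eLpNorm (fun x => g k x - weakGradient Ω φ x) 2 (volume.restrict Ω) ≤
      B + P * B := fun k => (hgB k).trans le_self_add
  obtain ⟨w, G, hwG, σ, hσ, hweak, hweakG⟩ := IsGradPairZero.exists_weak_limit hpair hC hUC hGC
  have hstrong := IsGradPairZero.tendsto_of_weak hΩ hΩb (fun k => hpair (σ k)) hC
    (fun k => hUC (σ k)) (fun k => hGC (σ k)) hwG.memLp hweak
  obtain ⟨τ, hτ, hae⟩ := (tendstoInMeasure_of_tendsto_eLpNorm (p := 2) two_ne_zero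
    (fun k => (hpair (σ k)).memLp.1) hwG.memLp.1 hstrong).exists_seq_tendsto_ae
  let s : ℕ → ℕ := fun k => σ (τ k)
  have hs : Tendsto s atTop atTop := hσ.tendsto_atTop.comp hτ.tendsto_atTop
  let u : EuclideanSpace ℝ (Fin n) → ℝ := fun x => w x + φ x
  let D : EuclideanSpace ℝ (Fin n) → EuclideanSpace ℝ (Fin n) :=
    fun x => G x + weakGradient Ω φ x
  have Hu : IsGradPair Ω u D := hwG.isGradPair.add Hφ
  have hu : u ∈ admissible Ω φ := by
    refine (mem_admissible_iff hΩ hΩb hφ).2 ⟨G, ?_⟩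
    simpa only [u, add_sub_cancel_right] using hwG
  have hpot : potentialEnergy Ω δ γ u ≤
      liminf (fun k => potentialEnergy Ω δ γ (v (s k))) atTop := by
    refine potentialEnergy_le_liminf hΩ hδm hγm hγ (fun k => (Hv _).memLp.1.aemeasurable) ?_
    filter_upwards [hae] with x hx
    simpa using hx.add_const (φ x)
  let N : ℝ := ∫ x in Ω, inner ℝ (D x) (D x)
  -- `c k` is the tangent plane of the Dirichlet energy at `D`, evaluated at the `k`-th gradient.
  -- Being affine in that gradient, it has a genuine limit under weak convergence, namely the
  -- Dirichlet energy of `D`.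
  let c : ℕ → ℝ≥0∞ := fun k =>
    ENNReal.ofReal ((∫ x in Ω, inner ℝ (g (s k) x) (D x)) - 1 / 2 * N)
  have hc : Tendsto c atTop (𝓝 (ENNReal.ofReal (1 / 2) *
      eLpNorm D 2 (volume.restrict Ω) ^ 2)) := by
    have h1 := (hweakG D Hu.memLp_grad).comp hτ.tendsto_atTop
    have h2 := (h1.add_const (∫ x in Ω, inner ℝ (weakGradient Ω φ x) (D x))).sub_const (1 / 2 * N)
    have e : ENNReal.ofReal (1 / 2) * eLpNorm D 2 (volume.restrict Ω) ^ 2 =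
        ENNReal.ofReal ((∫ x in Ω, inner ℝ (G x) (D x)) +
          (∫ x in Ω, inner ℝ (weakGradient Ω φ x) (D x)) - 1 / 2 * N) := by
      rw [← ofReal_integral_norm_sq Hu.memLp_grad, ← ENNReal.ofReal_mul (by norm_num),
        ← integral_add (integrable_inner_of_memLp_two hwG.memLp_grad Hu.memLp_grad)
          (integrable_inner_of_memLp_two Hφ.memLp_grad Hu.memLp_grad)]
      congr 1
      simp only [← inner_add_left]
      simp only [N, D]
      ring
    rw [e]
    refine (ENNReal.tendsto_ofReal h2).congr fun k => ?_
    simp only [c, Function.comp_apply]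
    congr 2
    rw [← integral_add (integrable_inner_of_memLp_two (hpair _).memLp_grad Hu.memLp_grad)
      (integrable_inner_of_memLp_two Hφ.memLp_grad Hu.memLp_grad)]
    simp only [← inner_add_left, sub_add_cancel]
    rfl
  have hck : ∀ k, c k + potentialEnergy Ω δ γ (v (s k)) ≤ m + ((s k : ℝ≥0∞) + 1)⁻¹ := by
    intro k
    refine le_trans ?_ (hvm (s k))
    rw [hve]
    exact add_le_add_left (ofReal_inner_sub_le_half_sq (Hv _).memLp_grad Hu.memLp_grad) _
  have hup : Tendsto (fun k => m + ((s k : ℝ≥0∞) + 1)⁻¹) atTop (𝓝 m) := by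
    have := (hlim1.comp hs).const_add m
    simpa [Function.comp_def] using this
  have hcm : ENNReal.ofReal (1 / 2) * eLpNorm D 2 (volume.restrict Ω) ^ 2 ≤ m :=
    le_of_tendsto_of_tendsto' hc hup fun k => le_self_add.trans (hck k)
  have hpot' : potentialEnergy Ω δ γ u ≤
      m - ENNReal.ofReal (1 / 2) * eLpNorm D 2 (volume.restrict Ω) ^ 2 := by
    refine hpot.trans ?_
    -- Since `c` converges, it can be subtracted from the energy bound before the liminf of the
    -- potentials is taken.
    rw [← (ENNReal.Tendsto.sub hup hc (Or.inl hmtop)).liminf_eq]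
    exact liminf_le_liminf (Eventually.of_forall fun k =>
      ENNReal.le_sub_of_add_le_left ENNReal.ofReal_ne_top (hck k))
  refine ⟨u, hu, fun z hz => ?_⟩
  calc energy Ω δ γ u = _ := energy_eq hΩ hΩb hδ Hu
    _ ≤ ENNReal.ofReal (1 / 2) * eLpNorm D 2 (volume.restrict Ω) ^ 2 +
        (m - ENNReal.ofReal (1 / 2) * eLpNorm D 2 (volume.restrict Ω) ^ 2) := by gcongr
    _ = m := add_tsub_cancel_of_le hcm
    _ ≤ energy Ω δ γ z := sInf_le (mem_image_of_mem _ hz)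

end Minimizers

end SobolevH1

end

theorem proposition2p1 {n : ℕ} (hn : 1 ≤ n)
    (Ω : Set (EuclideanSpace ℝ (Fin n)))
    (hΩ_open : IsOpen Ω) (hΩ_ne : Ω.Nonempty) (hΩ_bdd : Bornology.IsBounded Ω)
    (δ γ : EuclideanSpace ℝ (Fin n) → ℝ)
    (hδ_meas : AEMeasurable δ (volume.restrict Ω))
    (hδ_nonneg : ∀ x ∈ Ω, 0 ≤ δ x) (hδ_bdd : ∃ C : ℝ, ∀ x ∈ Ω, δ x ≤ C)
    (hγ_meas : AEMeasurable γ (volume.restrict Ω))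
    (hγ_nonneg : ∀ x ∈ Ω, 0 ≤ γ x) (hγ_bdd : ∃ C : ℝ, ∀ x ∈ Ω, γ x ≤ C)
    (hγ_inf : 0 < essInf γ (volume.restrict Ω))
    (hγ_sup : essSup γ (volume.restrict Ω) ≤ 1)
    (φ : EuclideanSpace ℝ (Fin n) → ℝ)
    (hφ_H1 : SobolevH1.MemH1 Ω φ) (hφ_Linfty : MemLp φ ∞ (volume.restrict Ω))
    (hφ_nonneg : ∀ᵐ x ∂(volume.restrict Ω), 0 ≤ φ x) :
    (∃ u, SobolevH1.IsMinimizer Ω δ γ φ u) ∧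
      ∀ u, SobolevH1.IsMinimizer Ω δ γ φ u →
        (∀ᵐ x ∂(volume.restrict Ω), 0 ≤ u x) ∧
        eLpNorm u ∞ (volume.restrict Ω) ≤ eLpNorm φ ∞ (volume.restrict Ω) := by

  obtain ⟨C, hδC⟩ := hδ_bdd
  have hγ1 : ∀ᵐ x ∂(volume.restrict Ω), γ x ≤ 1 := by
    obtain ⟨C', hγC⟩ := hγ_bdd
    -- For real-valued functions `essSup` is an a.e. upper bound only once essential boundedness
    -- above is known.
    have hb : IsBoundedUnder (· ≤ ·) (ae (volume.restrict Ω)) γ :=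
      ⟨C', eventually_map.2 ((ae_restrict_mem hΩ_open.measurableSet).mono fun x hx => hγC x hx)⟩
    exact (ae_le_essSup hb).mono fun x hx => hx.trans hγ_sup
  have hfin : ∀ v, SobolevH1.MemH1 Ω v → SobolevH1.potentialEnergy Ω δ γ v ≠ ⊤ := fun v hv =>
    SobolevH1.potentialEnergy_ne_top hΩ_open hΩ_bdd hδ_nonneg hδC hγ_nonneg hγ1 hv.1
  exact ⟨SobolevH1.exists_isMinimizer hn hΩ_open hΩ_bdd hδ_meas hδ_nonneg hγ_meas hγ_nonneg
    hφ_H1 (hfin φ hφ_H1), fun u hu => hu.nonneg_and_eLpNorm_le hn hΩ_open hΩ_bdd hδ_nonneg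
    hγ_nonneg hφ_H1 hφ_Linfty hφ_nonneg (hfin u hu.1.1)⟩
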